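/- Let $m\ge 0$, $-\infty\le a<b\le\infty$, $J=\begin{pmatrix}0&-I_m\\ I_m&0\end{pmatrix}$, and let $P,W$ be $2m\times 2m$ Hermitian matrix functions with entries in $L^1_{loc}(a,b)$ and $W\ge 0$ on $(a,b)$. Consider $$Jy'(t)=(P(t)+\lambda W(t))y(t),\qquad t\in(a,b),\tag{1}$$ solutions being locally absolutely continuous and equations holding almost everywhere. For $a\le a'<b'\le b$ let $\hat L^2_W(a',b')$ be the space of measurable $f:(a',b')\to\mathbb C^{2m}$ with $\int_{a'}^{b'} f^*Wf\,dt<\infty$, with semi-inner product $\int_{a'}^{b'} g^*Wf\,dt$, and let $L^2_W(a',b')$ be its quotient by the functions of seminorm $0$. Assume: (A) for every subinterval $(a',b')\subset(a,b)$, if $Jy'-Py=W\hat f$ and $Wy=0$ on $(a',b')$ for some $\hat f\in\hat L^2_W(a',b')$, then $y=0$ on $(a',b')$. The maximal operator $H$ in $L^2_W(a,b)$ maps (the class of) a locally absolutely continuous $y\in\hat L^2_W(a,b)$ to (the class of) $f\in\hat L^2_W(a,b)$ whenever $Jy'-Py=Wf$ on $(a,b)$; the minimal operator $H_0$ is the closure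 of the restriction of $H$ to those $y$ that have compact support in $(a,b)$. The same operators are defined on subintervals. Equation (1) is in the limit circle case at $b$ (at $a$) if for some $c\in(a,b)$ the minimal operator on $(c,b)$ (on $(a,c)$) has both defect indices, i.e. the dimensions of $R(H_0-\bar z)^\perp$ for $z=\pm i$, equal to $2m$. Assume that (1) is in the limit circle case at both $a$ and $b$. Put $(f,g)_c(t)=g^*(t)Jf(t)$, and let $(f,g)_c(a)$, $(f,g)_c(b)$ be its limits as $t\to a^+$, $t\to b^-$. Fix $c_0\in(a,b)$, let $\phi_{i,\lambda}$ ($1\le i\le 2m$) be the solutions of (1) with $(\phi_{1,\lambda}(c_0),\dots,\phi_{2m,\lambda}(c_0))=I_{2m}$, put $\phi_i=\phi_{i,0}$, and let $\Phi_\lambda(t)$ be the $2m\times2m$ matrix with $(j,i)$ entry $(\phi_{i,\lambda},\phi_j)_c(t)$, $t\in[a,b]$. Let $M,N$ be complex $2m\times2m$ matrices with $\operatorname{rank}(M,N)=2m$ and $MJM^*=NJN^*$, let $H_D$ be the restriction of $H$ (a self-adjoint extension of $H_0$) to $$D=\left\{y\in D(H):\ M\begin{pmatrix}(y,\phi_1)_c(a)\\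 \vdots\\ (y,\phi_{2m})_c(a)\end{pmatrix}-N\begin{pmatrix}(y,\phi_1)_c(b)\\ \vdots\\ (y,\phi_{2m})_c(b)\end{pmatrix}=0\right\},$$ and let $\Gamma_c(\lambda)=\det\bigl(M\Phi_\lambda(a)-N\Phi_\lambda(b)\bigr)$. Then the limits $\Phi_\lambda(a)$ and $\Phi_\lambda(b)$ exist for all $\lambda\in\mathbb C$, $\Gamma_c$ is an entire function, and for every eigenvalue $\lambda_0$ of $H_D$ the space of eigenfunctions $\{y\in D: H_Dy=\lambda_0y\}$ is finite-dimensional and its dimension equals the order of $\lambda_0$ as a zero of $\Gamma_c$. -/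

import Mathlib

open MeasureTheory Filter Topology Matrix
open scoped ComplexOrder

/-- The index set of the coordinates of `ℂ^{2m}`. -/
abbrev HIdx (m : ℕ) : Type := Fin m ⊕ Fin m

/-- The open interval `(a,b)` of real numbers with (possibly infinite) endpoints `a`, `b`. -/
def eInterval (a b : EReal) : Set ℝ := {t : ℝ | a < (t : EReal) ∧ (t : EReal) < b}

/-- The filter of `t → a⁺` (`t → -∞` if `a = -∞`). -/
noncomputable def leftEnd (a : EReal) : Filter ℝ := comap (fun t : ℝ => (t : EReal)) (𝓝[>] a)

/-- The filter of `t → b⁻` (`t → +∞` if `b = +∞`). -/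
noncomputable def rightEnd (b : EReal) : Filter ℝ := comap (fun t : ℝ => (t : EReal)) (𝓝[<] b)

/-- `J = (0, -I; I, 0)`. -/
def sympJ (m : ℕ) : Matrix (HIdx m) (HIdx m) ℂ := Matrix.fromBlocks 0 (-1) 1 0

/-- The coefficients of a continuous linear Hamiltonian system `J y' = (P + λ W) y` on `(a,b)`. -/
structure HamSystem (m : ℕ) (a b : EReal) where
  P : ℝ → Matrix (HIdx m) (HIdx m) ℂ
  W : ℝ → Matrix (HIdx m) (HIdx m) ℂ
  P_herm : ∀ t ∈ eInterval a b, (P t).IsHermitian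
  W_psd : ∀ t ∈ eInterval a b, (W t).PosSemidef
  P_loc : ∀ i j, LocallyIntegrableOn (fun t => P t i j) (eInterval a b)
  W_loc : ∀ i j, LocallyIntegrableOn (fun t => W t i j) (eInterval a b)

theorem eInterval_subset {a b a' b' : EReal} (ha : a ≤ a') (hb : b' ≤ b) :
    eInterval a' b' ⊆ eInterval a b :=
  fun _ ht => ⟨lt_of_le_of_lt ha ht.1, lt_of_lt_of_le ht.2 hb⟩

theorem measurableSet_eInterval (a b : EReal) : MeasurableSet (eInterval a b) :=
  (measurableSet_Ioo (a := a) (b := b)).preimage measurable_coe_real_ereal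

/-- `y` is locally absolutely continuous on `(a,b)`. -/
def ACLoc {m : ℕ} (a b : EReal) (y : ℝ → HIdx m → ℂ) : Prop :=
  ∀ c d : ℝ, a < (c : EReal) → c ≤ d → (d : EReal) < b → AbsolutelyContinuousOnInterval y c d

namespace HamSystem

variable {m : ℕ} {a b : EReal}

/-- The same system on a smaller interval. -/
def restrict (S : HamSystem m a b) (a' b' : EReal) (ha : a ≤ a') (hb : b' ≤ b) :
    HamSystem m a' b' where
  P := S.P
  W := S.W
  P_herm t ht := S.P_herm t (eInterval_subset ha hb ht)
  W_psd t ht := S.W_psd t (eInterval_subset ha hb ht)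
  P_loc i j := (S.P_loc i j).mono_set (eInterval_subset ha hb)
  W_loc i j := (S.W_loc i j).mono_set (eInterval_subset ha hb)

/-- The integrand `g^*(t) W(t) f(t)`. -/
def wform (S : HamSystem m a b) (g f : ℝ → HIdx m → ℂ) (t : ℝ) : ℂ :=
  star (g t) ⬝ᵥ (S.W t *ᵥ f t)

theorem wform_aesm (S : HamSystem m a b) {f g : ℝ → HIdx m → ℂ}
    (hg : AEStronglyMeasurable g (volume.restrict (eInterval a b)))
    (hf : AEStronglyMeasurable f (volume.restrict (eInterval a b))) :
    AEStronglyMeasurable (S.wform g f) (volume.restrict (eInterval a b)) := by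
  have hg' : ∀ i, AEStronglyMeasurable (fun t => g t i) (volume.restrict (eInterval a b)) :=
    fun i => (continuous_apply i).comp_aestronglyMeasurable hg
  have hf' : ∀ i, AEStronglyMeasurable (fun t => f t i) (volume.restrict (eInterval a b)) :=
    fun i => (continuous_apply i).comp_aestronglyMeasurable hf
  have hW : ∀ i j, AEStronglyMeasurable (fun t => S.W t i j) (volume.restrict (eInterval a b)) :=
    fun i j => (S.W_loc i j).aestronglyMeasurable
  have : S.wform g f = fun t => ∑ i, star (g t i) * ∑ j, S.W t i j * f t j := by
    funext t
    simp [wform, dotProduct, mulVec]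
  rw [this]
  refine Finset.aestronglyMeasurable_fun_sum _ fun i _ => ?_
  exact (continuous_star.comp_aestronglyMeasurable (hg' i)).mul
    (Finset.aestronglyMeasurable_fun_sum _ fun j _ => (hW i j).mul (hf' j))

theorem wform_self_nonneg (S : HamSystem m a b) (f : ℝ → HIdx m → ℂ) {t : ℝ}
    (ht : t ∈ eInterval a b) : 0 ≤ S.wform f f t :=
  (S.W_psd t ht).dotProduct_mulVec_nonneg (f t)

/-- The pre-space of measurable `f : (a,b) → ℂ^{2m}` with `∫ f^* W f < ∞`
(values outside `(a,b)` are irrelevant). -/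
def preL2 (S : HamSystem m a b) : Submodule ℂ (ℝ → HIdx m → ℂ) where
  carrier := {f | AEStronglyMeasurable f (volume.restrict (eInterval a b)) ∧
    IntegrableOn (S.wform f f) (eInterval a b)}
  zero_mem' := by
    refine ⟨aestronglyMeasurable_const, ?_⟩
    have : S.wform 0 0 = fun _ => 0 := by
      funext t
      simp [wform]
    rw [this]
    exact integrable_zero _ _ _
  add_mem' := by
    rintro f g ⟨hf, hf2⟩ ⟨hg, hg2⟩
    refine ⟨hf.add hg, ?_⟩
    refine Integrable.mono' ((hf2.add hg2).norm.const_mul 2) (S.wform_aesm (hf.add hg) (hf.add hg)) ?_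
    refine (ae_restrict_iff' (measurableSet_eInterval a b)).2 (Eventually.of_forall fun t ht => ?_)
    have h1 := S.wform_self_nonneg f ht
    have h2 := S.wform_self_nonneg g ht
    have h3 := S.wform_self_nonneg (f + g) ht
    have h4 := S.wform_self_nonneg (f - g) ht
    have key : S.wform (f + g) (f + g) t + S.wform (f - g) (f - g) t
        = 2 * (S.wform f f t + S.wform g g t) := by
      simp only [wform, Pi.add_apply, Pi.sub_apply, star_add, star_sub, mulVec_add, mulVec_sub,
        add_dotProduct, sub_dotProduct, dotProduct_add, dotProduct_sub]
      ring
    have h5 : S.wform (f + g) (f + g) t ≤ 2 * (S.wform f f t + S.wform g g t) := by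
      rw [← key]
      exact le_add_of_nonneg_right h4
    calc ‖S.wform (f + g) (f + g) t‖ ≤ ‖2 * (S.wform f f t + S.wform g g t)‖ :=
          CStarAlgebra.norm_le_norm_of_nonneg_of_le h3 h5
      _ = _ := by simp
  smul_mem' := by
    rintro c f ⟨hf, hf2⟩
    refine ⟨hf.const_smul c, ?_⟩
    have : S.wform (c • f) (c • f) = fun t => (star c * c) * S.wform f f t := by
      funext t
      simp only [wform, Pi.smul_apply, star_smul, mulVec_smul, smul_dotProduct, dotProduct_smul,
        smul_eq_mul]
      ring
    rw [this]
    exact hf2.const_mul _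

theorem wform_conj_symm (S : HamSystem m a b) (f g : ℝ → HIdx m → ℂ) {t : ℝ}
    (ht : t ∈ eInterval a b) : star (S.wform g f t) = S.wform f g t := by
  simp only [wform]
  rw [star_dotProduct, star_mulVec, (S.W_psd t ht).isHermitian.eq, star_star, ← dotProduct_mulVec]

/-- `g^* W f` is integrable for `f`, `g` in the pre-space. -/
theorem wform_integrable (S : HamSystem m a b) {f g : ℝ → HIdx m → ℂ} (hg : g ∈ S.preL2)
    (hf : f ∈ S.preL2) : IntegrableOn (S.wform g f) (eInterval a b) := by
  refine Integrable.mono' ((hf.2.add hg.2).norm) (S.wform_aesm hg.1 hf.1) ?_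
  refine (ae_restrict_iff' (measurableSet_eInterval a b)).2 (Eventually.of_forall fun t ht => ?_)
  have h1 := S.wform_self_nonneg f ht
  have h2 := S.wform_self_nonneg g ht
  obtain ⟨r, hr, hrf⟩ : ∃ r : ℂ, star r * r = 1 ∧ r * S.wform g f t = (‖S.wform g f t‖ : ℂ) := by
    by_cases h0 : S.wform g f t = 0
    · exact ⟨1, by simp, by simp [h0]⟩
    · have hn : (‖S.wform g f t‖ : ℂ) ≠ 0 := by simpa using h0
      refine ⟨star (S.wform g f t) / ‖S.wform g f t‖, ?_, ?_⟩
      · have := Complex.conj_mul' (S.wform g f t)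
        simp only [star_div₀, Complex.star_def, Complex.conj_ofReal,
          Complex.conj_conj] at *
        field_simp
        linear_combination this
      · have := Complex.conj_mul' (S.wform g f t)
        simp only [Complex.star_def] at *
        field_simp
        linear_combination this
  have hsymm : S.wform f g t = star (S.wform g f t) := (S.wform_conj_symm f g ht).symm
  have h4 := S.wform_self_nonneg (r • f - g) ht
  have key : S.wform (r • f - g) (r • f - g) t
      = S.wform f f t + S.wform g g t - 2 * (‖S.wform g f t‖ : ℂ) := by
    have hs : star r * star (S.wform g f t) = (‖S.wform g f t‖ : ℂ) := by
      rw [← star_mul', hrf]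
      simp
    rw [← hsymm] at hs
    have e : S.wform (r • f - g) (r • f - g) t = star r * r * S.wform f f t
        - star r * S.wform f g t - r * S.wform g f t + S.wform g g t := by
      simp only [wform, Pi.smul_apply, Pi.sub_apply, star_sub, star_smul, mulVec_sub, mulVec_smul,
        sub_dotProduct, dotProduct_sub, smul_dotProduct, dotProduct_smul, smul_eq_mul]
      ring
    rw [e, hr, hs, hrf]
    ring
  rw [key] at h4
  have h5 := (Complex.le_def.1 h4).1
  have h6 : ‖S.wform f f t + S.wform g g t‖ = (S.wform f f t + S.wform g g t).re :=
    (Complex.re_eq_norm.2 (add_nonneg h1 h2)).symm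
  have h7 := norm_nonneg (S.wform g f t)
  simp only [Pi.add_apply]
  rw [h6]
  simp at h5 ⊢
  linarith

/-- The pre-space as a type, which carries the semi-inner product `∫_a^b g^* W f`. -/
def PreL2 (S : HamSystem m a b) : Type := ↥S.preL2

noncomputable instance (S : HamSystem m a b) : AddCommGroup S.PreL2 :=
  inferInstanceAs (AddCommGroup ↥S.preL2)

noncomputable instance (S : HamSystem m a b) : Module ℂ S.PreL2 :=
  inferInstanceAs (Module ℂ ↥S.preL2)

/-- The function underlying an element of the pre-space. -/
def PreL2.fn {S : HamSystem m a b} (f : S.PreL2) : ℝ → HIdx m → ℂ := f.1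

/-- The semi-inner product, conjugate linear in the first argument as in Mathlib. -/
noncomputable instance preCore (S : HamSystem m a b) : PreInnerProductSpace.Core ℂ S.PreL2 where
  inner g f := ∫ t in eInterval a b, S.wform g.fn f.fn t
  conj_inner_symm g f := by
    rw [← integral_conj]
    refine setIntegral_congr_fun (measurableSet_eInterval a b) fun t ht => ?_
    exact S.wform_conj_symm g.fn f.fn ht
  re_inner_nonneg f := by
    have h := integral_re (S.wform_integrable f.2 f.2)
    change 0 ≤ RCLike.re (∫ t in eInterval a b, S.wform f.1 f.1 t)
    rw [← h]
    exact setIntegral_nonneg (measurableSet_eInterval a b) fun t ht =>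
      (Complex.le_def.1 (S.wform_self_nonneg _ ht)).1
  add_left f g h := by
    have e := integral_add (S.wform_integrable f.2 h.2) (S.wform_integrable g.2 h.2)
    refine Eq.trans ?_ e
    refine integral_congr_ae (Eventually.of_forall fun t => ?_)
    change star (f.1 t + g.1 t) ⬝ᵥ (S.W t *ᵥ h.1 t) = _
    simp [wform, add_dotProduct]
  smul_left f g r := by
    rw [← integral_const_mul]
    refine integral_congr_ae (Eventually.of_forall fun t => ?_)
    change star (r • f.fn t) ⬝ᵥ (S.W t *ᵥ g.fn t) = _
    simp [wform, smul_dotProduct]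

noncomputable instance (S : HamSystem m a b) : SeminormedAddCommGroup S.PreL2 :=
  InnerProductSpace.Core.toSeminormedAddCommGroup (𝕜 := ℂ)

noncomputable instance (S : HamSystem m a b) : InnerProductSpace ℂ S.PreL2 :=
  InnerProductSpace.ofCore (preCore S)

/-- The space `L²_W(a,b)`: the quotient of the pre-space by the functions of seminorm zero. -/
abbrev L2 (S : HamSystem m a b) : Type := SeparationQuotient S.PreL2

/-- The class of a function in `L²_W(a,b)`. -/
noncomputable def PreL2.cls {S : HamSystem m a b} (f : S.PreL2) : S.L2 := SeparationQuotient.mk f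

/-- `J y' - P y = W f` (almost everywhere) on `(a,b)`, with `y` locally absolutely continuous. -/
def Solves (S : HamSystem m a b) (y f : ℝ → HIdx m → ℂ) : Prop :=
  ACLoc a b y ∧ ∀ᵐ t : ℝ, t ∈ eInterval a b → ∃ y' : HIdx m → ℂ, HasDerivAt y y' t ∧
    sympJ m *ᵥ y' - S.P t *ᵥ y t = S.W t *ᵥ f t

/-- `y` is a solution of `J y' = (P + z W) y` on `(a,b)`. -/
def IsSolution (S : HamSystem m a b) (z : ℂ) (y : ℝ → HIdx m → ℂ) : Prop :=
  S.Solves y (z • y)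

theorem Solves.zero (S : HamSystem m a b) : S.Solves 0 0 := by
  refine ⟨fun c d _ _ _ => ?_, Eventually.of_forall fun t _ => ⟨0, ?_, ?_⟩⟩
  · exact ((LipschitzWith.const (0 : HIdx m → ℂ)).lipschitzOnWith).absolutelyContinuousOnInterval
  · exact hasDerivAt_const t (0 : HIdx m → ℂ)
  · simp

theorem Solves.add {S : HamSystem m a b} {y₁ f₁ y₂ f₂ : ℝ → HIdx m → ℂ} (h₁ : S.Solves y₁ f₁)
    (h₂ : S.Solves y₂ f₂) : S.Solves (y₁ + y₂) (f₁ + f₂) := by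
  refine ⟨fun c d hc hcd hd => (h₁.1 c d hc hcd hd).add (h₂.1 c d hc hcd hd), ?_⟩
  filter_upwards [h₁.2, h₂.2] with t ht₁ ht₂ ht
  obtain ⟨u, hu, eu⟩ := ht₁ ht
  obtain ⟨v, hv, ev⟩ := ht₂ ht
  refine ⟨u + v, hu.add hv, ?_⟩
  simp only [Pi.add_apply, mulVec_add, ← eu, ← ev]
  abel

theorem Solves.smul {S : HamSystem m a b} {y f : ℝ → HIdx m → ℂ} (c : ℂ) (h : S.Solves y f) :
    S.Solves (c • y) (c • f) := by
  refine ⟨fun s d hs hsd hd => (h.1 s d hs hsd hd).const_smul c, ?_⟩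
  filter_upwards [h.2] with t ht₁ ht
  obtain ⟨u, hu, eu⟩ := ht₁ ht
  refine ⟨c • u, hu.const_smul c, ?_⟩
  simp only [Pi.smul_apply, mulVec_smul, ← eu, smul_sub]

/-- `y` vanishes on `(a,b)` outside a compact subset of `(a,b)`. -/
def CompactSupp (a b : EReal) (y : ℝ → HIdx m → ℂ) : Prop :=
  ∃ c d : ℝ, a < (c : EReal) ∧ c ≤ d ∧ (d : EReal) < b ∧
    ∀ t ∈ eInterval a b, t ∉ Set.Icc c d → y t = 0

/-- The graph in `L²_W × L²_W` of the
restriction of `y ↦ f`, `J y' - P y = W f`, to the `y` with `p y`. (`W f` does not depend, up to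
null sets, on the representative of the class of `f`.) -/
def graphSet (S : HamSystem m a b) (p : (ℝ → HIdx m → ℂ) → Prop) : Set (S.L2 × S.L2) :=
  {q | ∃ y f : S.PreL2, y.cls = q.1 ∧ f.cls = q.2 ∧ S.Solves y.fn f.fn ∧ p y.fn}

/-- The graph of an operator, as a subspace, when the side condition `p` is linear. -/
def graph (S : HamSystem m a b) (p : (ℝ → HIdx m → ℂ) → Prop) (h0 : p 0)
    (hadd : ∀ y z, p y → p z → p (y + z)) (hsmul : ∀ (c : ℂ) y, p y → p (c • y)) :
    Submodule ℂ (S.L2 × S.L2) where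
  carrier := S.graphSet p
  zero_mem' := ⟨0, 0, rfl, rfl, Solves.zero S, h0⟩
  add_mem' := by
    rintro _ _ ⟨y, f, hy, hf, hs, hp⟩ ⟨z, g, hz, hg, hs', hp'⟩
    exact ⟨y + z, f + g, by rw [Prod.fst_add, ← hy, ← hz]; rfl,
      by rw [Prod.snd_add, ← hf, ← hg]; rfl, hs.add hs', hadd _ _ hp hp'⟩
  smul_mem' := by
    rintro c _ ⟨y, f, hy, hf, hs, hp⟩
    exact ⟨c • y, c • f, by rw [Prod.smul_fst, ← hy]; rfl,
      by rw [Prod.smul_snd, ← hf]; rfl, hs.smul c, hsmul c _ hp⟩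

/-- The graph of the maximal operator `H` (single-valued under `Definite`: `W y = 0` forces
`y = 0`, hence `W f = 0`). -/
def maxGraph (S : HamSystem m a b) : Submodule ℂ (S.L2 × S.L2) :=
  S.graph (fun _ => True) trivial (fun _ _ _ _ => trivial) (fun _ _ _ => trivial)

/-- The graph of the pre-minimal operator `H₀₀`; `a < b` is needed for `0` to have compact
support in the sense above. -/
def preMinGraph (S : HamSystem m a b) (hab : a < b) : Submodule ℂ (S.L2 × S.L2) :=
  S.graph (CompactSupp a b)
    (by
      obtain ⟨x, hx1, hx2⟩ := EReal.lt_iff_exists_real_btwn.1 hab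
      exact ⟨x, x, hx1, le_rfl, hx2, fun _ _ _ => rfl⟩)
    (by
      rintro y z ⟨c, d, hc, hcd, hd, h⟩ ⟨c', d', hc', hcd', hd', h'⟩
      refine ⟨min c c', max d d', ?_, ?_, ?_, fun t ht htn => ?_⟩
      · rcases min_choice c c' with e | e <;> rw [e] <;> assumption
      · exact (min_le_left _ _).trans (hcd.trans (le_max_left _ _))
      · rcases max_choice d d' with e | e <;> rw [e] <;> assumption
      · have h1 : t ∉ Set.Icc c d := fun hh =>
          htn ⟨(min_le_left _ _).trans hh.1, hh.2.trans (le_max_left _ _)⟩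
        have h2 : t ∉ Set.Icc c' d' := fun hh =>
          htn ⟨(min_le_right _ _).trans hh.1, hh.2.trans (le_max_right _ _)⟩
        simp [h t ht h1, h' t ht h2])
    (by
      rintro k y ⟨c, d, hc, hcd, hd, h⟩
      exact ⟨c, d, hc, hcd, hd, fun t ht htn => by simp [h t ht htn]⟩)

/-- The graph of the minimal operator `H₀`, the closure of `H₀₀`. -/
noncomputable def minGraph (S : HamSystem m a b) (hab : a < b) : Submodule ℂ (S.L2 × S.L2) :=
  (S.preMinGraph hab).topologicalClosure

/-- The defect space `R(H₀ - z̄)^⊥` of the minimal operator at `z`. -/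
noncomputable def defectSpace (S : HamSystem m a b) (hab : a < b) (z : ℂ) : Submodule ℂ S.L2 :=
  ((S.minGraph hab).map
    (LinearMap.snd ℂ S.L2 S.L2 - (starRingEnd ℂ z) • LinearMap.fst ℂ S.L2 S.L2))ᗮ

/-- Both defect indices of the minimal operator are equal to `2m`. -/
def FullDefect (S : HamSystem m a b) (hab : a < b) : Prop :=
  Module.finrank ℂ (S.defectSpace hab Complex.I) = 2 * m ∧
    Module.finrank ℂ (S.defectSpace hab (-Complex.I)) = 2 * m

/-- The limit circle case at `a`: the left minimal operator, on `(a,c)` with `c` inside `(a,b)`,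
has defect indices `2m`. -/
def LimitCircleLeft (S : HamSystem m a b) : Prop :=
  ∃ (c : ℝ) (hac : a < (c : EReal)) (hcb : (c : EReal) < b),
    (S.restrict a c le_rfl hcb.le).FullDefect hac

/-- The limit circle case at `b`: the right minimal operator, on `(c,b)` with `c` inside `(a,b)`,
has defect indices `2m`. -/
def LimitCircleRight (S : HamSystem m a b) : Prop :=
  ∃ (c : ℝ) (hac : a < (c : EReal)) (hcb : (c : EReal) < b),
    (S.restrict c b hac.le le_rfl).FullDefect hcb

/-- The definiteness assumption: on no subinterval is there a nonzero `y` with `J y' - P y = W f`,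
`f` in the pre-space of the subinterval, and `W y = 0`. -/
def Definite (S : HamSystem m a b) : Prop :=
  ∀ (a' b' : EReal) (ha : a ≤ a') (_ : a' < b') (hb : b' ≤ b),
    ∀ y f : ℝ → HIdx m → ℂ, f ∈ (S.restrict a' b' ha hb).preL2 →
      (S.restrict a' b' ha hb).Solves y f →
      (∀ᵐ t : ℝ, t ∈ eInterval a' b' → S.W t *ᵥ y t = 0) →
      ∀ t ∈ eInterval a' b', y t = 0

open Classical in
/-- The solution `φ_{i,z}` of `J y' = (P + z W) y` on `(a,b)` with `y(c₀) = e_i`. On `(a,b)` it is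
determined by these two properties; its existence is the Carathéodory theorem for linear systems
with locally integrable coefficients. -/
noncomputable def phi (S : HamSystem m a b) (c₀ : ℝ) (z : ℂ) (i : HIdx m) : ℝ → HIdx m → ℂ :=
  if h : ∃ y : ℝ → HIdx m → ℂ, S.IsSolution z y ∧ y c₀ = Pi.single i 1 then h.choose else 0

end HamSystem

/-- `(f,g)_c(t) = g^*(t) J f(t)`. -/
def bracket {m : ℕ} (f g : ℝ → HIdx m → ℂ) (t : ℝ) : ℂ := star (g t) ⬝ᵥ (sympJ m *ᵥ f t)

namespace HamSystem

variable {m : ℕ} {a b : EReal}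

/-- The matrix `Φ_z(t)` for `t` inside `(a,b)`: its `(j,i)` entry is `(φ_{i,z}, φ_j)_c(t)`, with
`φ_j = φ_{j,0}`. -/
noncomputable def Phi (S : HamSystem m a b) (c₀ : ℝ) (z : ℂ) (t : ℝ) :
    Matrix (HIdx m) (HIdx m) ℂ :=
  Matrix.of fun j i => bracket (S.phi c₀ z i) (S.phi c₀ 0 j) t

/-- `Φ_z(a)`, the limit as `t → a⁺`. -/
noncomputable def PhiLeft (S : HamSystem m a b) (c₀ : ℝ) (z : ℂ) : Matrix (HIdx m) (HIdx m) ℂ :=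
  limUnder (leftEnd a) (S.Phi c₀ z)

/-- `Φ_z(b)`, the limit as `t → b⁻`. -/
noncomputable def PhiRight (S : HamSystem m a b) (c₀ : ℝ) (z : ℂ) : Matrix (HIdx m) (HIdx m) ℂ :=
  limUnder (rightEnd b) (S.Phi c₀ z)

/-- `Γ_c(z) = det (M Φ_z(a) - N Φ_z(b))`. -/
noncomputable def Gam (S : HamSystem m a b) (c₀ : ℝ) (M N : Matrix (HIdx m) (HIdx m) ℂ) (z : ℂ) :
    ℂ :=
  (M * S.PhiLeft c₀ z - N * S.PhiRight c₀ z).det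

/-- The boundary condition `M ((y,φ_j)_c(a))_j - N ((y,φ_j)_c(b))_j = 0`; `u` and `v` are the
vectors of boundary values `(y,φ_j)_c(a)` and `(y,φ_j)_c(b)`, which are limits. -/
def BdryCond (S : HamSystem m a b) (c₀ : ℝ) (M N : Matrix (HIdx m) (HIdx m) ℂ)
    (y : ℝ → HIdx m → ℂ) : Prop :=
  ∃ u v : HIdx m → ℂ,
    Tendsto (fun t => fun j => bracket y (S.phi c₀ 0 j) t) (leftEnd a) (𝓝 u) ∧
    Tendsto (fun t => fun j => bracket y (S.phi c₀ 0 j) t) (rightEnd b) (𝓝 v) ∧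
    M *ᵥ u - N *ᵥ v = 0

/-- The graph of `H_D`, the restriction of the maximal operator to the domain given by the boundary
condition. -/
def HDGraph (S : HamSystem m a b) (c₀ : ℝ) (M N : Matrix (HIdx m) (HIdx m) ℂ) :
    Submodule ℂ (S.L2 × S.L2) :=
  S.graph (S.BdryCond c₀ M N)
    (by
      have e : (fun t => fun j => bracket (0 : ℝ → HIdx m → ℂ) (S.phi c₀ 0 j) t)
          = fun _ => (0 : HIdx m → ℂ) := by
        funext t j
        simp [bracket]
      exact ⟨0, 0, by rw [e]; exact tendsto_const_nhds, by rw [e]; exact tendsto_const_nhds,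
        by simp⟩)
    (by
      rintro y z ⟨u, v, hu, hv, h⟩ ⟨u', v', hu', hv', h'⟩
      have e : (fun t => fun j => bracket (y + z) (S.phi c₀ 0 j) t)
          = fun t => (fun j => bracket y (S.phi c₀ 0 j) t) +
            (fun j => bracket z (S.phi c₀ 0 j) t) := by
        funext t j
        simp [bracket, mulVec_add, dotProduct_add]
      refine ⟨u + u', v + v', by rw [e]; exact hu.add hu', by rw [e]; exact hv.add hv', ?_⟩
      rw [mulVec_add, mulVec_add, add_sub_add_comm, h, h', add_zero])
    (by
      rintro c y ⟨u, v, hu, hv, h⟩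
      have e : (fun t => fun j => bracket (c • y) (S.phi c₀ 0 j) t)
          = fun t => c • (fun j => bracket y (S.phi c₀ 0 j) t) := by
        funext t j
        simp [bracket, mulVec_smul, dotProduct_smul]
      refine ⟨c • u, c • v, by rw [e]; exact hu.const_smul c, by rw [e]; exact hv.const_smul c, ?_⟩
      rw [mulVec_smul, mulVec_smul, ← smul_sub, h, smul_zero])

end HamSystem

/-- The eigenspace `{y : T y = z y}` of the operator `T` with graph `G`. -/
def graphEigenspace {E : Type*} [AddCommGroup E] [Module ℂ E] (G : Submodule ℂ (E × E)) (z : ℂ) :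
    Submodule ℂ E :=
  G.comap (LinearMap.prod LinearMap.id (z • LinearMap.id))

/-- `z` is an eigenvalue of the operator with graph `G`. -/
def GraphEigenvalue {E : Type*} [AddCommGroup E] [Module ℂ E] (G : Submodule ℂ (E × E)) (z : ℂ) :
    Prop :=
  ∃ y : E, y ≠ 0 ∧ (y, z • y) ∈ G

/-! The boundary problem is reduced to the matrix `D(λ) = M Φ_λ(a) - N Φ_λ(b)`. The proof shows that
`D` is entire, that the eigenspace at `λ` is a copy of `ker D(λ)`, and that at a real point the
order of `det D` equals `dim ker D`.

Square-integrability. On a subinterval, variation of constants shows that every element of a defect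
space at `z` is the class of a solution for `z` (`exists_cls_eq_of_mem_defectSpace`). Defect index
`2m` then forces all solutions for `z = ±i` into the pre-space there, hence on `(a,b)`. For other
parameters, expand a solution `y` for `z` in solutions for `w = i`. Its coordinates `(y,
φ_{j,w̄})_c` satisfy `x' = (z - w) A x`, where `A` is built from the scalars `φ^* W φ` and is
integrable on all of `(a,b)`. They are therefore bounded, and `y` is square-integrable
(`IsSolution.mem_preL2`).

Boundary values. For `w = 0` the columns of `Φ_λ` are such coordinates, so they solve `x' = λ A x`
with `A` integrable. The Picard series is a power series in `λ` whose `n`-th term is at most `C (|λ|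
K)^n / n!` up to the endpoints. The limits can be taken termwise and are entire (`exists_flow_lim`,
`exists_Phi_lim`).

Eigenspaces. Sending an initial value to the class of its solution is injective by definiteness, and
it maps `ker D(λ)` onto the eigenspace (`graphEigenspace_eq`).

Multiplicity. If `D(λ₀) v₂ = 0` and `D(λ₀) v₁ + D'(λ₀) v₂ = 0` force `v₂ = 0`, then `D` is an
analytic factor invertible at `λ₀` times a factor with determinant `(λ - λ₀)^dim ker`
(`analyticOrderAt_det`). To exclude such chains, differentiate the Lagrange identity in `λ` at `λ₀`:
the boundary form of `Φ' v₂` against `Φ v₂` is the squared norm of the solution `y` with initial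
value `v₂`. Since `M, N` define a Lagrangian subspace, the boundary form vanishes on boundary values
satisfying the condition (`boundary_form_eq`). So the norm is zero and definiteness gives `v₂ = 0`
(`no_chain`). This uses that `λ₀` is real, which follows from the same identity without
differentiation. -/

/-! ### Intervals with extended real endpoints -/

theorem isOpen_eInterval (a b : EReal) : IsOpen (eInterval a b) :=
  (isOpen_Ioo (a := a) (b := b)).preimage continuous_coe_real_ereal

theorem Icc_subset_eInterval {a b : EReal} {s t : ℝ} (hs : a < (s : EReal))
    (ht : (t : EReal) < b) : Set.Icc s t ⊆ eInterval a b := fun _ hx =>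
  ⟨hs.trans_le (EReal.coe_le_coe_iff.2 hx.1), (EReal.coe_le_coe_iff.2 hx.2).trans_lt ht⟩

theorem uIcc_subset_eInterval {a b : EReal} {s t : ℝ} (hs : s ∈ eInterval a b)
    (ht : t ∈ eInterval a b) : Set.uIcc s t ⊆ eInterval a b := by
  rcases le_total s t with h | h
  · rw [Set.uIcc_of_le h]; exact Icc_subset_eInterval hs.1 ht.2
  · rw [Set.uIcc_of_ge h]; exact Icc_subset_eInterval ht.1 hs.2

/-- A property that holds almost everywhere on every compact subinterval of `(a,b)` holds almost
everywhere on `(a,b)`. -/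
theorem ae_eInterval_of_ae_Icc {a b : EReal} {p : ℝ → Prop}
    (h : ∀ c d : ℝ, a < (c : EReal) → c < d → (d : EReal) < b → ∀ᵐ t : ℝ, t ∈ Set.Icc c d → p t) :
    ∀ᵐ t : ℝ, t ∈ eInterval a b → p t := by
  -- Rational endpoints keep the union of exceptional null sets countable.
  have h' : ∀ q r : ℚ, ∀ᵐ t : ℝ, a < ((q : ℝ) : EReal) → (q : ℝ) < r → ((r : ℝ) : EReal) < b →
      t ∈ Set.Icc (q : ℝ) r → p t := by
    intro q r
    by_cases hq : a < ((q : ℝ) : EReal) ∧ (q : ℝ) < r ∧ ((r : ℝ) : EReal) < b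
    · filter_upwards [h q r hq.1 hq.2.1 hq.2.2] with t ht _ _ _ using ht
    · exact Eventually.of_forall fun t h1 h2 h3 => absurd ⟨h1, h2, h3⟩ hq
  filter_upwards [ae_all_iff.2 fun q => ae_all_iff.2 (h' q)] with t ht hab
  obtain ⟨q, hq1, hq2⟩ := EReal.lt_iff_exists_rat_btwn.1 hab.1
  obtain ⟨r, hr1, hr2⟩ := EReal.lt_iff_exists_rat_btwn.1 hab.2
  have hq2' : (q : ℝ) < t := EReal.coe_lt_coe_iff.1 hq2
  have hr1' : t < (r : ℝ) := EReal.coe_lt_coe_iff.1 hr1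
  exact ht q r hq1 (hq2'.trans hr1') hr2 ⟨hq2'.le, hr1'.le⟩

/-! ### Locally absolutely continuous primitives -/

section Primitive

variable {E F : Type*} [NormedAddCommGroup E] [NormedAddCommGroup F] {a b : EReal}

/-- `f` is integrable between any two points of `(a,b)`. -/
def LocIntegrable (a b : EReal) (f : ℝ → E) : Prop :=
  ∀ s ∈ eInterval a b, ∀ t ∈ eInterval a b, IntervalIntegrable f volume s t

theorem MeasureTheory.LocallyIntegrableOn.locIntegrable {f : ℝ → E}
    (hf : LocallyIntegrableOn f (eInterval a b)) : LocIntegrable a b f := fun _ hs _ ht =>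
  (hf.integrableOn_compact_subset (uIcc_subset_eInterval hs ht) isCompact_uIcc).intervalIntegrable

theorem MeasureTheory.IntegrableOn.locIntegrable {f : ℝ → E}
    (hf : IntegrableOn f (eInterval a b)) : LocIntegrable a b f := fun _ hs _ ht =>
  (hf.mono_set (uIcc_subset_eInterval hs ht)).intervalIntegrable

theorem LocIntegrable.integrableOn_Icc {f : ℝ → E} (hf : LocIntegrable a b f) {c d : ℝ}
    (hc : a < (c : EReal)) (hcd : c ≤ d) (hd : (d : EReal) < b) :
    IntegrableOn f (Set.Icc c d) := by
  have hs := Icc_subset_eInterval hc hd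
  exact (intervalIntegrable_iff_integrableOn_Icc_of_le hcd).1
    (hf c (hs ⟨le_rfl, hcd⟩) d (hs ⟨hcd, le_rfl⟩))

theorem LocIntegrable.fun_sum {ι : Type*} (u : Finset ι) {f : ι → ℝ → E}
    (hf : ∀ i ∈ u, LocIntegrable a b (f i)) : LocIntegrable a b (fun t => ∑ i ∈ u, f i t) := by
  intro s hs t ht
  have := IntervalIntegrable.sum u (f := f) (μ := volume) (a := s) (b := t)
    (fun i hi => hf i hi s hs t ht)
  rwa [Finset.sum_fn] at this

theorem LocIntegrable.norm {f : ℝ → E} (hf : LocIntegrable a b f) :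
    LocIntegrable a b (fun t => ‖f t‖) := fun s hs t ht => (hf s hs t ht).norm

theorem LocIntegrable.mul_continuousOn {𝕜 : Type*} [NormedRing 𝕜] {f g : ℝ → 𝕜}
    (hf : LocIntegrable a b f) (hg : ContinuousOn g (eInterval a b)) :
    LocIntegrable a b (fun t => f t * g t) :=
  fun s hs t ht => (hf s hs t ht).mul_continuousOn (hg.mono (uIcc_subset_eInterval hs ht))

theorem LocIntegrable.continuousOn_mul {𝕜 : Type*} [NormedRing 𝕜] {f g : ℝ → 𝕜}
    (hf : LocIntegrable a b f) (hg : ContinuousOn g (eInterval a b)) :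
    LocIntegrable a b (fun t => g t * f t) :=
  fun s hs t ht => (hf s hs t ht).continuousOn_mul (hg.mono (uIcc_subset_eInterval hs ht))

theorem LocIntegrable.pi {ι : Type*} [Fintype ι] {f : ℝ → ι → ℂ}
    (hf : ∀ i, LocIntegrable a b (fun t => f t i)) : LocIntegrable a b f := by
  intro s hs t ht
  rw [intervalIntegrable_iff]
  exact Integrable.of_eval fun i => (intervalIntegrable_iff.1 (hf i s hs t ht))

/-- The sums in the definition are dominated term by term. This transfers absolute continuity to
components, conjugates, modifications outside the interval and vector-valued integrals. -/
theorem AbsolutelyContinuousOnInterval.of_dist_le {f : ℝ → E} {g : ℝ → F} {c d : ℝ}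
    (hg : AbsolutelyContinuousOnInterval g c d) (C : ℝ)
    (h : ∀ s ∈ Set.uIcc c d, ∀ t ∈ Set.uIcc c d, dist (f s) (f t) ≤ C * dist (g s) (g t)) :
    AbsolutelyContinuousOnInterval f c d := by
  unfold AbsolutelyContinuousOnInterval at hg ⊢
  refine squeeze_zero' (Eventually.of_forall fun _ => Finset.sum_nonneg fun _ _ => dist_nonneg) ?_
    (by simpa using hg.const_mul C)
  rw [eventually_inf_principal]
  refine Eventually.of_forall fun E hE => ?_
  rw [Finset.mul_sum]
  exact Finset.sum_le_sum fun i hi => h _ (hE.1 i hi).1 _ (hE.1 i hi).2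

variable [NormedSpace ℝ E]

/-- The increments are bounded by those of the real primitive of `‖g‖`. -/
theorem AbsolutelyContinuousOnInterval.intervalIntegral {g : ℝ → E} {c d x : ℝ}
    (hg : IntervalIntegrable g volume c d) (hx : x ∈ Set.uIcc c d) :
    AbsolutelyContinuousOnInterval (fun t => ∫ s in x..t, g s) c d := by
  refine (hg.norm.absolutelyContinuousOnInterval_intervalIntegral hx).of_dist_le 1 ?_
  intro s hs t ht
  have hi : ∀ u ∈ Set.uIcc c d, ∀ v ∈ Set.uIcc c d, IntervalIntegrable g volume u v :=
    fun u hu v hv => hg.mono_set (Set.uIcc_subset_uIcc hu hv)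
  rw [dist_eq_norm, dist_eq_norm, one_mul,
    intervalIntegral.integral_interval_sub_left (hi _ hx _ hs) (hi _ hx _ ht),
    intervalIntegral.integral_interval_sub_left (hi _ hx _ hs).norm (hi _ hx _ ht).norm]
  exact intervalIntegral.norm_integral_le_abs_integral_norm

theorem AbsolutelyContinuousOnInterval.of_pi {ι : Type*} [Fintype ι] {f : ℝ → ι → ℂ} {c d : ℝ}
    (h : ∀ i, AbsolutelyContinuousOnInterval (fun t => f t i) c d) :
    AbsolutelyContinuousOnInterval f c d := by
  unfold AbsolutelyContinuousOnInterval at h ⊢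
  refine squeeze_zero (fun _ => Finset.sum_nonneg fun _ _ => dist_nonneg) (fun E => ?_)
    (by simpa using tendsto_finsetSum Finset.univ fun i _ => h i)
  rw [Finset.sum_comm]
  refine Finset.sum_le_sum fun k _ => ?_
  refine (dist_pi_le_iff (Finset.sum_nonneg fun _ _ => dist_nonneg)).2 fun i => ?_
  exact Finset.single_le_sum (f := fun i => dist (f (E.2 k).1 i) (f (E.2 k).2 i))
    (fun _ _ => dist_nonneg) (Finset.mem_univ i)

/-- `f` is locally absolutely continuous on `(a,b)`, with derivative `g` almost everywhere. -/
def IsPrimitiveOn (a b : EReal) (f g : ℝ → E) : Prop :=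
  (∀ c d : ℝ, a < (c : EReal) → c ≤ d → (d : EReal) < b → AbsolutelyContinuousOnInterval f c d) ∧
    ∀ᵐ t : ℝ, t ∈ eInterval a b → HasDerivAt f (g t) t

namespace IsPrimitiveOn

variable {f f' g g' : ℝ → E}

theorem ac (h : IsPrimitiveOn a b f g) {s t : ℝ} (hs : s ∈ eInterval a b)
    (ht : t ∈ eInterval a b) : AbsolutelyContinuousOnInterval f s t := by
  rcases le_total s t with hst | hst
  · exact h.1 s t hs.1 hst ht.2
  · exact (h.1 t s ht.1 hst hs.2).symm

theorem continuousOn (h : IsPrimitiveOn a b f g) : ContinuousOn f (eInterval a b) := by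
  intro t ht
  obtain ⟨q, hq1, hq2⟩ := EReal.lt_iff_exists_real_btwn.1 ht.1
  obtain ⟨r, hr1, hr2⟩ := EReal.lt_iff_exists_real_btwn.1 ht.2
  have hq := EReal.coe_lt_coe_iff.1 hq2
  have hr := EReal.coe_lt_coe_iff.1 hr1
  have := (h.1 q r hq1 (hq.trans hr).le hr2).continuousOn
  rw [Set.uIcc_of_le (hq.trans hr).le] at this
  exact (this.continuousAt (Icc_mem_nhds hq hr)).continuousWithinAt

theorem mono (h : IsPrimitiveOn a b f g) {a' b' : EReal} (ha : a ≤ a') (hb : b' ≤ b) :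
    IsPrimitiveOn a' b' f g :=
  ⟨fun c d hc hcd hd => h.1 c d (ha.trans_lt hc) hcd (hd.trans_le hb), by
    filter_upwards [h.2] with t ht ht' using ht (eInterval_subset ha hb ht')⟩

theorem congr_ae (h : IsPrimitiveOn a b f g) (hg : ∀ᵐ t : ℝ, t ∈ eInterval a b → g t = g' t) :
    IsPrimitiveOn a b f g' :=
  ⟨h.1, by filter_upwards [h.2, hg] with t h1 h2 ht using h2 ht ▸ h1 ht⟩

theorem congr_deriv (h : IsPrimitiveOn a b f g) (hg : ∀ t ∈ eInterval a b, g t = g' t) :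
    IsPrimitiveOn a b f g' := h.congr_ae (Eventually.of_forall hg)

theorem congr_fun (h : IsPrimitiveOn a b f g) (hf : ∀ t ∈ eInterval a b, f t = f' t) :
    IsPrimitiveOn a b f' g := by
  refine ⟨fun c d hc hcd hd => (h.1 c d hc hcd hd).of_dist_le 1 fun s hs t ht => ?_, ?_⟩
  · rw [Set.uIcc_of_le hcd] at hs ht
    have := Icc_subset_eInterval hc hd
    rw [hf s (this hs), hf t (this ht), one_mul]
  · filter_upwards [h.2] with t h1 ht
    refine (h1 ht).congr_of_eventuallyEq ?_
    filter_upwards [(isOpen_eInterval a b).mem_nhds ht] with s hs using (hf s hs).symm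

theorem const (x : E) : IsPrimitiveOn a b (fun _ => x) (fun _ => 0) :=
  ⟨fun _ _ _ _ _ => (LipschitzWith.const x).lipschitzOnWith.absolutelyContinuousOnInterval,
    Eventually.of_forall fun t _ => hasDerivAt_const t x⟩

theorem add (h : IsPrimitiveOn a b f g) (h' : IsPrimitiveOn a b f' g') :
    IsPrimitiveOn a b (fun t => f t + f' t) (fun t => g t + g' t) :=
  ⟨fun c d hc hcd hd => (h.1 c d hc hcd hd).add (h'.1 c d hc hcd hd), by
    filter_upwards [h.2, h'.2] with t h1 h2 ht using (h1 ht).add (h2 ht)⟩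

theorem sub (h : IsPrimitiveOn a b f g) (h' : IsPrimitiveOn a b f' g') :
    IsPrimitiveOn a b (fun t => f t - f' t) (fun t => g t - g' t) :=
  ⟨fun c d hc hcd hd => (h.1 c d hc hcd hd).sub (h'.1 c d hc hcd hd), by
    filter_upwards [h.2, h'.2] with t h1 h2 ht using (h1 ht).sub (h2 ht)⟩

theorem sum {ι : Type*} (u : Finset ι) {f g : ι → ℝ → E}
    (h : ∀ i ∈ u, IsPrimitiveOn a b (f i) (g i)) :
    IsPrimitiveOn a b (fun t => ∑ i ∈ u, f i t) (fun t => ∑ i ∈ u, g i t) := by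
  classical
  induction u using Finset.induction_on with
  | empty => simpa using const (a := a) (b := b) (0 : E)
  | insert i u hi ih =>
    simp only [Finset.sum_insert hi]
    exact (h i (Finset.mem_insert_self i u)).add
      (ih fun j hj => h j (Finset.mem_insert_of_mem hj))

theorem mul {𝕜 : Type*} [NormedField 𝕜] [NormedAlgebra ℝ 𝕜] {f f' g g' : ℝ → 𝕜}
    (h : IsPrimitiveOn a b f g) (h' : IsPrimitiveOn a b f' g') :
    IsPrimitiveOn a b (fun t => f t * f' t) (fun t => g t * f' t + f t * g' t) :=
  ⟨fun c d hc hcd hd => (h.1 c d hc hcd hd).smul (h'.1 c d hc hcd hd), by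
    filter_upwards [h.2, h'.2] with t h1 h2 ht using (h1 ht).mul (h2 ht)⟩

theorem pow {f g : ℝ → ℝ} (h : IsPrimitiveOn a b f g) (n : ℕ) :
    IsPrimitiveOn a b (fun t => f t ^ (n + 1)) (fun t => (n + 1) * (g t * f t ^ n)) := by
  induction n with
  | zero => simpa using h
  | succ n ih =>
    simp only [pow_succ _ (n + 1)]
    refine (ih.mul h).congr_deriv fun t _ => ?_
    push_cast
    ring

theorem star_comp {f g : ℝ → ℂ} (h : IsPrimitiveOn a b f g) :
    IsPrimitiveOn a b (fun t => star (f t)) (fun t => star (g t)) :=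
  ⟨fun c d hc hcd hd => (h.1 c d hc hcd hd).of_dist_le 1 fun s _ t _ => by
      rw [one_mul, dist_eq_norm, dist_eq_norm, ← star_sub, norm_star],
    by filter_upwards [h.2] with t h1 ht using (h1 ht).star⟩

theorem eval {ι : Type*} [Fintype ι] {f g : ℝ → ι → ℂ} (h : IsPrimitiveOn a b f g) (i : ι) :
    IsPrimitiveOn a b (fun t => f t i) (fun t => g t i) :=
  ⟨fun c d hc hcd hd => (h.1 c d hc hcd hd).of_dist_le 1 fun s _ t _ => by
      rw [one_mul]; exact dist_le_pi_dist _ _ i,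
    by filter_upwards [h.2] with t h1 ht using hasDerivAt_pi.1 (h1 ht) i⟩

theorem pi {ι : Type*} [Fintype ι] {f g : ℝ → ι → ℂ}
    (h : ∀ i, IsPrimitiveOn a b (fun t => f t i) (fun t => g t i)) : IsPrimitiveOn a b f g :=
  ⟨fun c d hc hcd hd => .of_pi fun i => (h i).1 c d hc hcd hd, by
    filter_upwards [ae_all_iff.2 fun i => (h i).2] with t ht ht'
      using hasDerivAt_pi.2 fun i => ht i ht'⟩

theorem eq_of_deriv_eq_zero (h : IsPrimitiveOn a b f (fun _ => 0)) {s t : ℝ}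
    (hs : s ∈ eInterval a b) (ht : t ∈ eInterval a b) : f s = f t := by
  obtain ⟨C, hC⟩ := (h.ac hs ht).const_of_ae_hasDerivAt_zero (by
    filter_upwards [h.2] with x hx hx' using hx (uIcc_subset_eInterval hs ht hx'))
  rw [hC s Set.left_mem_uIcc, hC t Set.right_mem_uIcc]

variable [CompleteSpace E]

theorem of_integral (hg : LocIntegrable a b g) {c₀ : ℝ} (hc : c₀ ∈ eInterval a b) (x : E) :
    IsPrimitiveOn a b (fun t => x + ∫ s in c₀..t, g s) g := by
  have key : IsPrimitiveOn a b (fun t => ∫ s in c₀..t, g s) g := by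
    -- The facts about primitives on a compact interval want the base point inside it, so `[c, d]`
    -- is enlarged to contain `c₀`.
    have aux : ∀ c d : ℝ, a < (c : EReal) → c ≤ d → (d : EReal) < b →
        ∃ c' d' : ℝ, c' ≤ c ∧ d ≤ d' ∧ c₀ ∈ Set.uIcc c' d' ∧ IntervalIntegrable g volume c' d' := by
      intro c d h1 h2 h3
      have h1' : a < ((min c c₀ : ℝ) : EReal) := by
        rcases min_choice c c₀ with e | e <;> rw [e]
        exacts [h1, hc.1]
      have h3' : ((max d c₀ : ℝ) : EReal) < b := by
        rcases max_choice d c₀ with e | e <;> rw [e]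
        exacts [h3, hc.2]
      have hle : min c c₀ ≤ max d c₀ := (min_le_right _ _).trans (le_max_right _ _)
      have hs := Icc_subset_eInterval h1' h3'
      refine ⟨min c c₀, max d c₀, min_le_left _ _, le_max_left _ _, ?_,
        hg _ (hs ⟨le_rfl, hle⟩) _ (hs ⟨hle, le_rfl⟩)⟩
      rw [Set.uIcc_of_le hle]
      exact ⟨min_le_right _ _, le_max_right _ _⟩
    refine ⟨fun c d h1 h2 h3 => ?_, ae_eInterval_of_ae_Icc fun c d h1 h2 h3 => ?_⟩
    · obtain ⟨c', d', hc', hd', hm, hi⟩ := aux c d h1 h2 h3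
      refine (AbsolutelyContinuousOnInterval.intervalIntegral hi hm).mono ?_
      rw [Set.uIcc_of_le h2, Set.uIcc_of_le (hc'.trans (h2.trans hd'))]
      exact Set.Icc_subset_Icc hc' hd'
    · obtain ⟨c', d', hc', hd', hm, hi⟩ := aux c d h1 h2.le h3
      filter_upwards [hi.ae_hasDerivAt_integral] with t ht ht'
      refine ht ?_ c₀ hm
      rw [Set.uIcc_of_le (hc'.trans (h2.le.trans hd'))]
      exact Set.Icc_subset_Icc hc' hd' ht'
  simpa using (const x).add key

/-- The function `f` and the integral of `g` are both primitives of `g`. Their difference is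
absolutely continuous with derivative zero almost everywhere, hence constant. -/
theorem integral_eq_sub (h : IsPrimitiveOn a b f g) (hg : LocIntegrable a b g) {s t : ℝ}
    (hs : s ∈ eInterval a b) (ht : t ∈ eInterval a b) : ∫ x in s..t, g x = f t - f s := by
  have h0 := (h.sub (of_integral hg hs 0)).congr_deriv (g' := fun _ => 0) fun t _ => sub_self _
  have := h0.eq_of_deriv_eq_zero hs ht
  simp only [intervalIntegral.integral_same, add_zero, sub_zero, zero_add] at this
  rw [this, sub_sub_cancel]

end IsPrimitiveOn

end Primitive

/-! ### Linear systems with locally integrable coefficients -/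

section LinearODE

open scoped Nat

variable {ι : Type*} [Fintype ι] {a b : EReal} {A : ℝ → Matrix ι ι ℂ} {c₀ : ℝ}

/-- The sum of the absolute values of the entries of a matrix. -/
noncomputable def entrySum (M : Matrix ι ι ℂ) : ℝ := ∑ i, ∑ j, ‖M i j‖

theorem entrySum_nonneg (M : Matrix ι ι ℂ) : 0 ≤ entrySum M :=
  Finset.sum_nonneg fun _ _ => Finset.sum_nonneg fun _ _ => norm_nonneg _

theorem norm_mulVec_le_entrySum (M : Matrix ι ι ℂ) (v : ι → ℂ) :
    ‖M *ᵥ v‖ ≤ entrySum M * ‖v‖ := by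
  refine (pi_norm_le_iff_of_nonneg (mul_nonneg (entrySum_nonneg M) (norm_nonneg v))).2 fun i => ?_
  calc ‖(M *ᵥ v) i‖ ≤ ∑ j, ‖M i j * v j‖ := norm_sum_le _ _
    _ ≤ ∑ j, ‖M i j‖ * ‖v‖ := Finset.sum_le_sum fun j _ => by
        rw [norm_mul]
        exact mul_le_mul_of_nonneg_left (norm_le_pi_norm v j) (norm_nonneg _)
    _ = (∑ j, ‖M i j‖) * ‖v‖ := by rw [Finset.sum_mul]
    _ ≤ entrySum M * ‖v‖ := mul_le_mul_of_nonneg_right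
        (Finset.single_le_sum (f := fun i => ∑ j, ‖M i j‖)
          (fun _ _ => Finset.sum_nonneg fun _ _ => norm_nonneg _) (Finset.mem_univ i))
        (norm_nonneg _)

/-- The matrix function `A` has locally integrable entries on `(a,b)`. -/
def LocIntegrableEntries (a b : EReal) (A : ℝ → Matrix ι ι ℂ) : Prop :=
  ∀ i j, LocIntegrable a b (fun t => A t i j)

theorem LocIntegrableEntries.entrySum (hA : LocIntegrableEntries a b A) :
    LocIntegrable a b (fun t => entrySum (A t)) :=
  .fun_sum _ fun i _ => .fun_sum _ fun j _ => (hA i j).norm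

theorem LocIntegrableEntries.mulVec (hA : LocIntegrableEntries a b A) {f : ℝ → ι → ℂ}
    (hf : ContinuousOn f (eInterval a b)) : LocIntegrable a b (fun t => A t *ᵥ f t) :=
  .pi fun i => .fun_sum _ fun j _ =>
    (hA i j).mul_continuousOn ((continuous_apply j).comp_continuousOn hf)

/-- The signed integral of the size of the coefficient matrix from `c₀` to `t`. -/
noncomputable def mass (A : ℝ → Matrix ι ι ℂ) (c₀ t : ℝ) : ℝ := ∫ s in c₀..t, entrySum (A s)

theorem mass_isPrimitiveOn (hA : LocIntegrableEntries a b A) (hc : c₀ ∈ eInterval a b) :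
    IsPrimitiveOn a b (mass A c₀) (fun t => entrySum (A t)) := by
  have := IsPrimitiveOn.of_integral hA.entrySum hc 0
  simpa using! this

/-- With `μ` the mass, `μ' μ^n` has primitive `μ^(n+1) / (n+1)`. To the left of `c₀` the mass is
nonpositive, and the absolute value only contributes a factor `(-1)^n`. -/
theorem abs_integral_entrySum_mul_mass_pow (hA : LocIntegrableEntries a b A)
    (hc : c₀ ∈ eInterval a b) {t : ℝ} (ht : t ∈ eInterval a b) (n : ℕ) :
    |∫ s in c₀..t, entrySum (A s) * |mass A c₀ s| ^ n| = |mass A c₀ t| ^ (n + 1) / (n + 1) := by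
  have hm := mass_isPrimitiveOn hA hc
  have hint : LocIntegrable a b (fun s => ((n : ℝ) + 1) * (entrySum (A s) * mass A c₀ s ^ n)) := by
    intro s hs t ht
    exact (hA.entrySum.mul_continuousOn (hm.continuousOn.pow n) s hs t ht).const_mul _
  have h1 := (hm.pow n).integral_eq_sub hint hc ht
  have h0 : mass A c₀ c₀ = 0 := by simp [mass]
  rw [h0, intervalIntegral.integral_const_mul] at h1
  have hn : (0 : ℝ) < n + 1 := by positivity
  have h2 : |∫ s in c₀..t, entrySum (A s) * mass A c₀ s ^ n|
      = |mass A c₀ t| ^ (n + 1) / (n + 1) := by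
    rw [eq_div_iff hn.ne', ← abs_pow]
    calc _ = |∫ s in c₀..t, entrySum (A s) * mass A c₀ s ^ n| * |(n : ℝ) + 1| := by
          rw [abs_of_pos hn]
      _ = _ := by rw [← abs_mul, mul_comm, h1]; simp
  rw [← h2]
  rcases le_total c₀ t with h | h
  · congr 1
    refine intervalIntegral.integral_congr fun s hs => ?_
    rw [Set.uIcc_of_le h] at hs
    have : 0 ≤ mass A c₀ s :=
      intervalIntegral.integral_nonneg hs.1 fun _ _ => entrySum_nonneg _
    simp only [abs_of_nonneg this]
  · have e : ∫ s in c₀..t, entrySum (A s) * |mass A c₀ s| ^ n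
        = ∫ s in c₀..t, (-1) ^ n * (entrySum (A s) * mass A c₀ s ^ n) := by
      refine intervalIntegral.integral_congr fun s hs => ?_
      rw [Set.uIcc_of_ge h] at hs
      have : mass A c₀ s ≤ 0 := by
        rw [mass, intervalIntegral.integral_symm, neg_nonpos]
        exact intervalIntegral.integral_nonneg hs.2 fun _ _ => entrySum_nonneg _
      simp only [abs_of_nonpos this, neg_pow (mass A c₀ s) n]
      ring
    rw [e, intervalIntegral.integral_const_mul, abs_mul, abs_pow]
    simp

/-- The induction step of Picard iteration, with the mass in place of the length of the interval. It
serves both uniqueness and the convergence of the series. -/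
theorem norm_integral_mulVec_le (hA : LocIntegrableEntries a b A)
    (hc : c₀ ∈ eInterval a b) {t : ℝ} (ht : t ∈ eInterval a b) {f : ℝ → ι → ℂ} {C : ℝ}
    (hC : 0 ≤ C) (n : ℕ) (hf : ∀ s ∈ Set.uIcc c₀ t, ‖f s‖ ≤ C * (|mass A c₀ s| ^ n / n !)) :
    ‖∫ s in c₀..t, A s *ᵥ f s‖ ≤ C * (|mass A c₀ t| ^ (n + 1) / (n + 1)!) := by
  have hm := (mass_isPrimitiveOn hA hc).continuousOn
  have hint := hA.entrySum.mul_continuousOn (hm.abs.pow n) c₀ hc t ht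
  have h1 : ‖∫ s in c₀..t, A s *ᵥ f s‖
      ≤ |∫ s in c₀..t, (C / n !) * (entrySum (A s) * |mass A c₀ s| ^ n)| := by
    refine intervalIntegral.norm_integral_le_abs_of_norm_le ?_ (hint.const_mul _)
    refine (ae_restrict_iff' measurableSet_uIoc).2 (Eventually.of_forall fun s hs => ?_)
    refine (norm_mulVec_le_entrySum _ _).trans ?_
    have := mul_le_mul_of_nonneg_left (hf s (Set.uIoc_subset_uIcc hs)) (entrySum_nonneg (A s))
    refine this.trans (le_of_eq ?_)
    ring
  refine h1.trans (le_of_eq ?_)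
  rw [intervalIntegral.integral_const_mul, abs_mul,
    abs_integral_entrySum_mul_mass_pow hA hc ht n, abs_of_nonneg (by positivity), Nat.factorial_succ]
  push_cast
  field_simp

/-- The solution of a homogeneous linear system which vanishes at a point is zero. -/
theorem IsPrimitiveOn.eq_zero_of_linear (hA : LocIntegrableEntries a b A) {x : ℝ → ι → ℂ}
    (hx : IsPrimitiveOn a b x (fun t => A t *ᵥ x t)) (hc : c₀ ∈ eInterval a b) (h0 : x c₀ = 0)
    {t : ℝ} (ht : t ∈ eInterval a b) : x t = 0 := by
  obtain ⟨B, hB⟩ := isCompact_uIcc.exists_bound_of_continuousOn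
    (hx.continuousOn.mono (uIcc_subset_eInterval hc ht))
  have hB0 : 0 ≤ B := (norm_nonneg _).trans (hB c₀ Set.left_mem_uIcc)
  -- Inserting the bound into the integral equation `n` times makes it arbitrarily small.
  have key : ∀ n : ℕ, ∀ s ∈ Set.uIcc c₀ t, ‖x s‖ ≤ B * (|mass A c₀ s| ^ n / n !) := by
    intro n
    induction n with
    | zero => simpa using hB
    | succ n ih =>
      intro s hs
      have hs' := uIcc_subset_eInterval hc ht hs
      have := hx.integral_eq_sub (hA.mulVec hx.continuousOn) hc hs'
      rw [h0, sub_zero] at this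
      rw [← this]
      exact norm_integral_mulVec_le hA hc hs' hB0 n fun u hu =>
        ih u (Set.uIcc_subset_uIcc_left hs hu)
  have hlim : Tendsto (fun n : ℕ => B * (|mass A c₀ t| ^ n / n !)) atTop (𝓝 (B * 0)) :=
    (FloorSemiring.tendsto_pow_div_factorial_atTop _).const_mul B
  rw [mul_zero] at hlim
  exact norm_le_zero_iff.1 (ge_of_tendsto' hlim fun n => key n t Set.right_mem_uIcc)

/-! ### Solutions as power series in the parameter -/

/-- The Picard iterates of `x' = A x`, `x(c₀) = x₀`. -/
noncomputable def picard (A : ℝ → Matrix ι ι ℂ) (c₀ : ℝ) (x₀ : ι → ℂ) : ℕ → ℝ → ι → ℂ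
  | 0 => fun _ => x₀
  | n + 1 => fun t => ∫ s in c₀..t, A s *ᵥ picard A c₀ x₀ n s

/-- The solution of `x' = z A x`, `x(c₀) = x₀`, as a power series in `z`. -/
noncomputable def flow (A : ℝ → Matrix ι ι ℂ) (c₀ : ℝ) (x₀ : ι → ℂ) (z : ℂ) (t : ℝ) : ι → ℂ :=
  ∑' n : ℕ, z ^ n • picard A c₀ x₀ n t

variable {x₀ : ι → ℂ}

theorem picard_norm_le (hA : LocIntegrableEntries a b A) (hc : c₀ ∈ eInterval a b) (n : ℕ) {t : ℝ}
    (ht : t ∈ eInterval a b) : ‖picard A c₀ x₀ n t‖ ≤ ‖x₀‖ * (|mass A c₀ t| ^ n / n !) := by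
  induction n generalizing t with
  | zero => simp [picard]
  | succ n ih =>
    exact norm_integral_mulVec_le hA hc ht (norm_nonneg _) n fun s hs =>
      ih (uIcc_subset_eInterval hc ht hs)

theorem picard_continuousOn (hA : LocIntegrableEntries a b A) (hc : c₀ ∈ eInterval a b) (n : ℕ) :
    ContinuousOn (picard A c₀ x₀ n) (eInterval a b) := by
  induction n with
  | zero => exact continuousOn_const
  | succ n ih =>
    have := (IsPrimitiveOn.of_integral (hA.mulVec ih) hc 0).continuousOn
    simpa using! this

theorem picard_smul_continuousOn (hA : LocIntegrableEntries a b A) (hc : c₀ ∈ eInterval a b)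
    (n : ℕ) (z : ℂ) : ContinuousOn (fun t => z ^ n • picard A c₀ x₀ n t) (eInterval a b) :=
  (picard_continuousOn hA hc n).const_smul (z ^ n)

theorem norm_pow_smul_le {L : ι → ℂ} {C K R : ℝ} {n : ℕ} (hL : ‖L‖ ≤ C * (K ^ n / n !))
    {z : ℂ} (hz : ‖z‖ ≤ R) : ‖z ^ n • L‖ ≤ C * ((R * K) ^ n / n !) := by
  have hR : 0 ≤ R := (norm_nonneg z).trans hz
  rw [norm_smul, norm_pow, mul_pow]
  calc ‖z‖ ^ n * ‖L‖ ≤ R ^ n * (C * (K ^ n / n !)) :=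
        mul_le_mul (pow_le_pow_left₀ (norm_nonneg _) hz n) hL (norm_nonneg _) (pow_nonneg hR n)
    _ = _ := by ring

theorem summable_pow_smul {L : ℕ → ι → ℂ} {C K : ℝ} (hL : ∀ n, ‖L n‖ ≤ C * (K ^ n / n !)) (z : ℂ) :
    Summable fun n => z ^ n • L n :=
  .of_norm_bounded ((Real.summable_pow_div_factorial (‖z‖ * K)).mul_left C)
    fun n => norm_pow_smul_le (hL n) le_rfl

/-- The factorial bound gives uniform convergence on every disc. It applies to values at interior
points and equally to limits at the endpoints. -/
theorem differentiable_tsum_pow_smul {L : ℕ → ι → ℂ} {C K : ℝ}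
    (hL : ∀ n, ‖L n‖ ≤ C * (K ^ n / n !)) : Differentiable ℂ fun z : ℂ => ∑' n, z ^ n • L n := by
  intro z
  have hd : DifferentiableOn ℂ (fun z : ℂ => ∑' n, z ^ n • L n) (Metric.ball 0 (‖z‖ + 1)) := by
    refine Complex.differentiableOn_tsum_of_summable_norm
      ((Real.summable_pow_div_factorial ((‖z‖ + 1) * K)).mul_left C)
      (fun n => ?_) Metric.isOpen_ball fun n w hw => ?_
    · exact ((differentiable_id.pow n).smul_const (L n)).differentiableOn
    · exact norm_pow_smul_le (hL n) (mem_ball_zero_iff.1 hw).le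
  exact hd.differentiableAt (Metric.isOpen_ball.mem_nhds (by simp))

theorem flow_norm_le (hA : LocIntegrableEntries a b A) (hc : c₀ ∈ eInterval a b) (z : ℂ) {t : ℝ}
    (ht : t ∈ eInterval a b) : ‖flow A c₀ x₀ z t‖ ≤ ‖x₀‖ * Real.exp (‖z‖ * |mass A c₀ t|) := by
  have h := (NormedSpace.expSeries_div_hasSum_exp (‖z‖ * |mass A c₀ t|)).mul_left ‖x₀‖
  rw [← Real.exp_eq_exp_ℝ] at h
  exact tsum_of_norm_bounded h fun n => norm_pow_smul_le (picard_norm_le hA hc n ht) le_rfl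

theorem flow_differentiable (hA : LocIntegrableEntries a b A) (hc : c₀ ∈ eInterval a b) {t : ℝ}
    (ht : t ∈ eInterval a b) : Differentiable ℂ fun z => flow A c₀ x₀ z t :=
  differentiable_tsum_pow_smul fun n => picard_norm_le hA hc n ht

theorem flow_self (z : ℂ) : flow A c₀ x₀ z c₀ = x₀ := by
  rw [flow, tsum_eq_single 0]
  · simp [picard]
  · rintro (_ | n) h
    · exact absurd rfl h
    · simp [picard]

theorem flow_continuousOn (hA : LocIntegrableEntries a b A) (hc : c₀ ∈ eInterval a b) (z : ℂ) :
    ContinuousOn (flow A c₀ x₀ z) (eInterval a b) := by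
  intro t ht
  obtain ⟨q, hq1, hq2⟩ := EReal.lt_iff_exists_real_btwn.1 ht.1
  obtain ⟨r, hr1, hr2⟩ := EReal.lt_iff_exists_real_btwn.1 ht.2
  have hsub := Icc_subset_eInterval hq1 hr2
  obtain ⟨K, hK⟩ := isCompact_Icc.exists_bound_of_continuousOn
    ((mass_isPrimitiveOn hA hc).continuousOn.mono hsub)
  have : ContinuousOn (flow A c₀ x₀ z) (Set.Icc q r) := by
    refine continuousOn_tsum (fun n => (picard_smul_continuousOn hA hc n z).mono hsub)
      ((Real.summable_pow_div_factorial (‖z‖ * K)).mul_left ‖x₀‖) fun n s hs => ?_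
    refine norm_pow_smul_le ((picard_norm_le hA hc n (hsub hs)).trans ?_) le_rfl
    have := hK s hs
    rw [Real.norm_eq_abs] at this
    gcongr
  exact (this.continuousAt (Icc_mem_nhds (EReal.coe_lt_coe_iff.1 hq2)
    (EReal.coe_lt_coe_iff.1 hr1))).continuousWithinAt

/-- Sum and integral are exchanged by dominated convergence. Multiplication by `z` then shifts the
series by one index, and `x₀` is the missing zeroth term. -/
theorem flow_eq_integral (hA : LocIntegrableEntries a b A) (hc : c₀ ∈ eInterval a b) (z : ℂ)
    {t : ℝ} (ht : t ∈ eInterval a b) :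
    flow A c₀ x₀ z t = x₀ + ∫ s in c₀..t, z • A s *ᵥ flow A c₀ x₀ z s := by
  have hsub := uIcc_subset_eInterval hc ht
  obtain ⟨K, hK⟩ := isCompact_uIcc.exists_bound_of_continuousOn
    ((mass_isPrimitiveOn hA hc).continuousOn.mono hsub)
  have hbd : ∀ n, ∀ s ∈ Set.uIcc c₀ t, ‖picard A c₀ x₀ n s‖ ≤ ‖x₀‖ * (K ^ n / n !) := by
    intro n s hs
    refine (picard_norm_le hA hc n (hsub hs)).trans ?_
    have := hK s hs
    rw [Real.norm_eq_abs] at this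
    gcongr
  have hsum := (Real.summable_pow_div_factorial (‖z‖ * K)).mul_left ‖x₀‖
  have hS : HasSum (fun n => ∫ s in c₀..t, A s *ᵥ (z ^ n • picard A c₀ x₀ n s))
      (∫ s in c₀..t, A s *ᵥ flow A c₀ x₀ z s) := by
    refine intervalIntegral.hasSum_integral_of_dominated_convergence
      (fun n s => entrySum (A s) * (‖x₀‖ * ((‖z‖ * K) ^ n / n !))) (fun n => ?_) (fun n => ?_)
      (Eventually.of_forall fun s _ => hsum.mul_left _) ?_ (Eventually.of_forall fun s hs => ?_)
    · exact (hA.mulVec (picard_smul_continuousOn hA hc n z) c₀ hc t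
        ht).aestronglyMeasurable_restrict_uIoc
    · refine Eventually.of_forall fun s hs => (norm_mulVec_le_entrySum _ _).trans ?_
      exact mul_le_mul_of_nonneg_left
        (norm_pow_smul_le (hbd n s (Set.uIoc_subset_uIcc hs)) le_rfl) (entrySum_nonneg _)
    · simp only [tsum_mul_left]
      exact (hA.entrySum c₀ hc t ht).mul_const _
    · have h1 := (summable_pow_smul (fun n => hbd n s (Set.uIoc_subset_uIcc hs)) z).hasSum
      have hcont : Continuous fun v : ι → ℂ => A s *ᵥ v := by fun_prop
      exact h1.map (Matrix.mulVecLin (A s)).toAddMonoidHom hcont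
  have hS' : HasSum (fun n => z ^ (n + 1) • picard A c₀ x₀ (n + 1) t)
      (∫ s in c₀..t, z • A s *ᵥ flow A c₀ x₀ z s) := by
    rw [intervalIntegral.integral_smul]
    convert hS.const_smul z using 2 with n
    simp only [mulVec_smul, intervalIntegral.integral_smul, picard, pow_succ', mul_smul]
  rw [flow, (summable_pow_smul (fun n => hbd n t Set.right_mem_uIcc) z).tsum_eq_zero_add,
    hS'.tsum_eq]
  simp [picard]

theorem LocIntegrableEntries.smul (hA : LocIntegrableEntries a b A) (z : ℂ) :
    LocIntegrableEntries a b (fun t => z • A t) := fun i j s hs t ht =>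
  (hA i j s hs t ht).const_mul z

theorem flow_isPrimitiveOn (hA : LocIntegrableEntries a b A) (hc : c₀ ∈ eInterval a b) (z : ℂ) :
    IsPrimitiveOn a b (flow A c₀ x₀ z) (fun t => z • A t *ᵥ flow A c₀ x₀ z t) := by
  have hl : LocIntegrable a b fun t => z • A t *ᵥ flow A c₀ x₀ z t := fun s hs t ht =>
    (hA.mulVec (flow_continuousOn hA hc z) s hs t ht).smul z
  have h := IsPrimitiveOn.of_integral hl hc x₀
  have e : ∀ t ∈ eInterval a b, flow A c₀ x₀ z t = x₀ + ∫ s in c₀..t, z • A s *ᵥ flow A c₀ x₀ z s :=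
    fun t ht => flow_eq_integral hA hc z ht
  exact h.congr_fun fun t ht => (e t ht).symm

/-- Every solution of `x' = z A x` is given by the power series. -/
theorem IsPrimitiveOn.eq_flow (hA : LocIntegrableEntries a b A) (hc : c₀ ∈ eInterval a b) {z : ℂ}
    {x : ℝ → ι → ℂ} (hx : IsPrimitiveOn a b x (fun t => z • A t *ᵥ x t)) {t : ℝ}
    (ht : t ∈ eInterval a b) : x t = flow A c₀ (x c₀) z t := by
  have h := (hx.sub (flow_isPrimitiveOn (x₀ := x c₀) hA hc z)).congr_deriv
    (g' := fun t => (z • A t) *ᵥ (x t - flow A c₀ (x c₀) z t)) fun t _ => by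
      rw [mulVec_sub, smul_mulVec, smul_mulVec]
  have := h.eq_zero_of_linear (hA.smul z) hc (by rw [flow_self, sub_self]) ht
  exact sub_eq_zero.1 this

/-! #### Endpoints -/

/-- `l` is the filter of an endpoint of `(a,b)`, at which primitives of integrable functions have
limits. -/
structure IsEndpoint (a b : EReal) (l : Filter ℝ) : Prop where
  neBot : l.NeBot
  mem : ∀ᶠ t in l, t ∈ eInterval a b
  exists_lim : ∀ c ∈ eInterval a b, ∀ f : ℝ → ℂ, IntegrableOn f (eInterval a b) →
    ∃ L, Tendsto (fun t => ∫ s in c..t, f s) l (𝓝 L)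

theorem tendsto_integral_rightEnd {c : ℝ} (hc : c ∈ eInterval a b) {f : ℝ → ℂ}
    (hf : IntegrableOn f (eInterval a b)) :
    Tendsto (fun t => ∫ s in c..t, f s) (rightEnd b) (𝓝 (∫ s in eInterval c b, f s)) := by
  have hmem : ∀ u : ℝ, (u : EReal) < b → ∀ᶠ t in rightEnd b, u < t ∧ (t : EReal) < b := by
    intro u hu
    refine mem_comap.2 ⟨Set.Ioo u b, Ioo_mem_nhdsLT hu, fun t ht => ?_⟩
    exact ⟨EReal.coe_lt_coe_iff.1 ht.1, ht.2⟩
  have hcov : AECover (volume.restrict (eInterval c b)) (rightEnd b) (fun t => Set.Ioc c t) := by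
    refine ⟨(ae_restrict_iff' (measurableSet_eInterval _ _)).2 (Eventually.of_forall fun u hu => ?_),
      fun _ => measurableSet_Ioc⟩
    filter_upwards [hmem u hu.2] with t ht using ⟨EReal.coe_lt_coe_iff.1 hu.1, ht.1.le⟩
  have : (rightEnd b).IsCountablyGenerated := by unfold rightEnd; infer_instance
  have h := hcov.integral_tendsto_of_countably_generated
    (hf.mono_set (eInterval_subset hc.1.le le_rfl))
  refine h.congr' ?_
  filter_upwards [hmem c hc.2] with t ht
  rw [intervalIntegral.integral_of_le ht.1.le, Measure.restrict_restrict measurableSet_Ioc,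
    Set.inter_eq_left.2 fun u hu => ?_]
  exact ⟨EReal.coe_lt_coe_iff.2 hu.1, (EReal.coe_le_coe_iff.2 hu.2).trans_lt ht.2⟩

theorem tendsto_integral_leftEnd {c : ℝ} (hc : c ∈ eInterval a b) {f : ℝ → ℂ}
    (hf : IntegrableOn f (eInterval a b)) :
    Tendsto (fun t => ∫ s in c..t, f s) (leftEnd a) (𝓝 (-∫ s in eInterval a c, f s)) := by
  have hmem : ∀ u : ℝ, a < (u : EReal) → ∀ᶠ t in leftEnd a, t < u ∧ a < (t : EReal) := by
    intro u hu
    refine mem_comap.2 ⟨Set.Ioo a u, Ioo_mem_nhdsGT hu, fun t ht => ?_⟩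
    exact ⟨EReal.coe_lt_coe_iff.1 ht.2, ht.1⟩
  have hcov : AECover (volume.restrict (eInterval a c)) (leftEnd a) (fun t => Set.Ioo t c) := by
    refine ⟨(ae_restrict_iff' (measurableSet_eInterval _ _)).2 (Eventually.of_forall fun u hu => ?_),
      fun _ => measurableSet_Ioo⟩
    filter_upwards [hmem u hu.1] with t ht using ⟨ht.1, EReal.coe_lt_coe_iff.1 hu.2⟩
  have : (leftEnd a).IsCountablyGenerated := by unfold leftEnd; infer_instance
  have h := (hcov.integral_tendsto_of_countably_generated
    (hf.mono_set (eInterval_subset le_rfl hc.2.le))).neg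
  refine h.congr' ?_
  filter_upwards [hmem c hc.1] with t ht
  rw [intervalIntegral.integral_of_ge ht.1.le, Measure.restrict_restrict measurableSet_Ioo,
    integral_Ioc_eq_integral_Ioo, Set.inter_eq_left.2 fun u hu => ?_]
  exact ⟨ht.2.trans (EReal.coe_lt_coe_iff.2 hu.1), EReal.coe_lt_coe_iff.2 hu.2⟩

theorem isEndpoint_rightEnd (hab : a < b) : IsEndpoint a b (rightEnd b) where
  neBot := by
    refine comap_neBot_iff.2 fun s hs => ?_
    obtain ⟨u, hu, hus⟩ := (mem_nhdsLT_iff_exists_Ioo_subset' hab).1 hs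
    obtain ⟨x, hx1, hx2⟩ := EReal.lt_iff_exists_real_btwn.1 hu
    exact ⟨x, hus ⟨hx1, hx2⟩⟩
  mem := mem_comap.2 ⟨Set.Ioo a b, Ioo_mem_nhdsLT hab, fun _ ht => ht⟩
  exists_lim _ hc _ hf := ⟨_, tendsto_integral_rightEnd hc hf⟩

theorem isEndpoint_leftEnd (hab : a < b) : IsEndpoint a b (leftEnd a) where
  neBot := by
    refine comap_neBot_iff.2 fun s hs => ?_
    obtain ⟨u, hu, hus⟩ := (mem_nhdsGT_iff_exists_Ioo_subset' hab).1 hs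
    obtain ⟨x, hx1, hx2⟩ := EReal.lt_iff_exists_real_btwn.1 hu
    exact ⟨x, hus ⟨hx1, hx2⟩⟩
  mem := mem_comap.2 ⟨Set.Ioo a b, Ioo_mem_nhdsGT hab, fun _ ht => ht⟩
  exists_lim _ hc _ hf := ⟨_, tendsto_integral_leftEnd hc hf⟩

theorem integral_eInterval_split {c : ℝ} (hc : c ∈ eInterval a b) {f : ℝ → ℂ}
    (hf : IntegrableOn f (eInterval a b)) :
    (∫ s in eInterval c b, f s) + ∫ s in eInterval a c, f s = ∫ s in eInterval a b, f s := by
  have hd : Disjoint (eInterval (c : EReal) b) (eInterval a c) :=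
    Set.disjoint_left.2 fun u h1 h2 => lt_asymm h1.1 h2.2
  rw [← setIntegral_union hd (measurableSet_eInterval _ _)
    (hf.mono_set (eInterval_subset hc.1.le le_rfl)) (hf.mono_set (eInterval_subset le_rfl hc.2.le))]
  refine setIntegral_congr_set ?_
  have hne : ∀ᵐ t : ℝ, t ≠ c := by simp [ae_iff, measure_singleton]
  filter_upwards [hne] with t ht
  refine propext ⟨fun h => ?_, fun h => ?_⟩
  · rcases h with h | h
    exacts [eInterval_subset hc.1.le le_rfl h, eInterval_subset le_rfl hc.2.le h]
  · rcases lt_or_gt_of_ne ht with h' | h'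
    · exact Or.inr ⟨h.1, EReal.coe_lt_coe_iff.2 h'⟩
    · exact Or.inl ⟨EReal.coe_lt_coe_iff.2 h', h.2⟩

/-- The matrix function `A` has integrable entries on `(a,b)`. -/
def IntegrableEntries (a b : EReal) (A : ℝ → Matrix ι ι ℂ) : Prop :=
  ∀ i j, IntegrableOn (fun t => A t i j) (eInterval a b)

theorem IntegrableEntries.loc (hA : IntegrableEntries a b A) : LocIntegrableEntries a b A :=
  fun i j => (hA i j).locIntegrable

/-- Integrability on all of `(a,b)` bounds the mass by the total integral, so the estimates on the
Picard series become uniform up to the endpoints. -/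
theorem IntegrableEntries.exists_mass_le (hA : IntegrableEntries a b A) (hc : c₀ ∈ eInterval a b) :
    ∃ K, 0 ≤ K ∧ ∀ t ∈ eInterval a b, |mass A c₀ t| ≤ K := by
  have hi : IntegrableOn (fun t => entrySum (A t)) (eInterval a b) :=
    integrable_finsetSum _ fun i _ => integrable_finsetSum _ fun j _ => (hA i j).norm
  refine ⟨∫ t in eInterval a b, entrySum (A t),
    integral_nonneg fun _ => entrySum_nonneg _, fun t ht => ?_⟩
  refine (intervalIntegral.norm_integral_le_integral_norm_uIoc (f := fun s => entrySum (A s))).trans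
    ?_
  simp only [Real.norm_eq_abs, abs_of_nonneg (entrySum_nonneg _)]
  exact setIntegral_mono_set hi (Eventually.of_forall fun _ => entrySum_nonneg _)
    (Set.uIoc_subset_uIcc.trans (uIcc_subset_eInterval hc ht)).eventuallyLE

theorem exists_flow_bound (hA : IntegrableEntries a b A) (hc : c₀ ∈ eInterval a b) (R : ℝ) :
    ∃ B, ∀ z : ℂ, ‖z‖ ≤ R → ∀ t ∈ eInterval a b, ‖flow A c₀ x₀ z t‖ ≤ B := by
  obtain ⟨K, hK0, hK⟩ := hA.exists_mass_le hc
  refine ⟨‖x₀‖ * Real.exp (R * K), fun z hz t ht => (flow_norm_le hA.loc hc z ht).trans ?_⟩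
  have := hK t ht
  have hR : 0 ≤ R := (norm_nonneg z).trans hz
  gcongr

/-- The preceding iterate is bounded on `(a,b)`, so its product with `A` is integrable there and the
primitive has limits at the endpoints. -/
theorem exists_picard_lim (hA : IntegrableEntries a b A) (hc : c₀ ∈ eInterval a b) {l : Filter ℝ}
    (hl : IsEndpoint a b l) (n : ℕ) : ∃ L, Tendsto (picard A c₀ x₀ n) l (𝓝 L) := by
  rcases n with _ | n
  · exact ⟨x₀, tendsto_const_nhds⟩
  obtain ⟨K, hK0, hK⟩ := hA.exists_mass_le hc
  have hbd : ∀ t ∈ eInterval a b, ‖picard A c₀ x₀ n t‖ ≤ ‖x₀‖ * (K ^ n / n !) := by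
    intro t ht
    refine (picard_norm_le hA.loc hc n ht).trans ?_
    have := hK t ht
    gcongr
  have hcont := picard_continuousOn (x₀ := x₀) hA.loc hc n
  have hi : ∀ i, IntegrableOn (fun t => (A t *ᵥ picard A c₀ x₀ n t) i) (eInterval a b) := by
    intro i
    refine integrable_finsetSum _ fun j _ => (hA i j).mul_bdd (c := ‖x₀‖ * (K ^ n / n !)) ?_ ?_
    · exact ((continuous_apply j).comp_continuousOn hcont).aestronglyMeasurable
        (measurableSet_eInterval a b)
    · exact (ae_restrict_iff' (measurableSet_eInterval a b)).2
        (Eventually.of_forall fun t ht => (norm_le_pi_norm _ j).trans (hbd t ht))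
  choose L hL using fun i => hl.exists_lim c₀ hc _ (hi i)
  refine ⟨L, tendsto_pi_nhds.2 fun i => (hL i).congr' ?_⟩
  filter_upwards [hl.mem] with t ht
  have hv := intervalIntegrable_iff.1 (hA.loc.mulVec hcont c₀ hc t ht)
  simp only [picard, intervalIntegral.intervalIntegral_eq_integral_uIoc, Pi.smul_apply]
  rw [eval_integral fun i => hv.eval i]

/-- If the coefficients are integrable on `(a,b)`, then the solutions have limits at the endpoints,
which are entire functions of the parameter. -/
theorem exists_flow_lim (hA : IntegrableEntries a b A) (hc : c₀ ∈ eInterval a b) {l : Filter ℝ}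
    (hl : IsEndpoint a b l) : ∃ L : ℂ → ι → ℂ, Differentiable ℂ L ∧
      ∀ z, Tendsto (flow A c₀ x₀ z) l (𝓝 (L z)) := by
  choose L hL using exists_picard_lim (x₀ := x₀) hA hc hl
  obtain ⟨K, hK0, hK⟩ := hA.exists_mass_le hc
  have hbd : ∀ t ∈ eInterval a b, ∀ n, ‖picard A c₀ x₀ n t‖ ≤ ‖x₀‖ * (K ^ n / n !) := by
    intro t ht n
    refine (picard_norm_le hA.loc hc n ht).trans ?_
    have := hK t ht
    gcongr
  have hLn : ∀ n, ‖L n‖ ≤ ‖x₀‖ * (K ^ n / n !) := by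
    intro n
    have := hl.neBot
    refine le_of_tendsto (hL n).norm ?_
    filter_upwards [hl.mem] with t ht using hbd t ht n
  refine ⟨fun z => ∑' n, z ^ n • L n, differentiable_tsum_pow_smul hLn, fun z => ?_⟩
  -- The bound does not depend on `t`, so the limit may be taken term by term.
  refine tendsto_tsum_of_dominated_convergence
    ((Real.summable_pow_div_factorial (‖z‖ * K)).mul_left ‖x₀‖) (fun n => (hL n).const_smul _) ?_
  filter_upwards [hl.mem] with t ht n using norm_pow_smul_le (hbd t ht n) le_rfl

end LinearODE

/-! ### Solutions of the Hamiltonian system -/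

theorem sympJ_mul_self (m : ℕ) : sympJ m * sympJ m = -1 := by
  rw [sympJ, fromBlocks_multiply, ← fromBlocks_one, fromBlocks_neg]
  simp

theorem sympJ_conjTranspose (m : ℕ) : (sympJ m)ᴴ = -sympJ m := by
  rw [sympJ, fromBlocks_conjTranspose, fromBlocks_neg]
  simp

theorem sympJ_mulVec_mulVec {m : ℕ} (v : HIdx m → ℂ) : sympJ m *ᵥ sympJ m *ᵥ v = -v := by
  rw [mulVec_mulVec, sympJ_mul_self, neg_mulVec, one_mulVec]

theorem star_dotProduct_sympJ_mulVec {m : ℕ} (u v : HIdx m → ℂ) :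
    star u ⬝ᵥ (sympJ m *ᵥ v) = -(star (sympJ m *ᵥ u) ⬝ᵥ v) := by
  rw [star_mulVec, sympJ_conjTranspose, vecMul_neg, neg_dotProduct, neg_neg, dotProduct_mulVec]

theorem IsPrimitiveOn.mulVec {ι κ : Type*} [Fintype ι] [Fintype κ] {a b : EReal}
    {A A' : ℝ → Matrix κ ι ℂ} {x x' : ℝ → ι → ℂ}
    (hA : ∀ i j, IsPrimitiveOn a b (fun t => A t i j) (fun t => A' t i j))
    (hx : IsPrimitiveOn a b x x') :
    IsPrimitiveOn a b (fun t => A t *ᵥ x t) (fun t => A' t *ᵥ x t + A t *ᵥ x' t) := by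
  refine .pi fun i => ?_
  refine (IsPrimitiveOn.sum Finset.univ fun j _ => (hA i j).mul (hx.eval j)).congr_deriv
    fun t _ => ?_
  simp [Matrix.mulVec, dotProduct, Finset.sum_add_distrib]

theorem IsPrimitiveOn.star_dotProduct {ι : Type*} [Fintype ι] {a b : EReal}
    {u u' x x' : ℝ → ι → ℂ} (hu : IsPrimitiveOn a b u u') (hx : IsPrimitiveOn a b x x') :
    IsPrimitiveOn a b (fun t => star (u t) ⬝ᵥ x t)
      (fun t => star (u' t) ⬝ᵥ x t + star (u t) ⬝ᵥ x' t) := by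
  refine (IsPrimitiveOn.sum Finset.univ fun j _ =>
    (hu.eval j).star_comp.mul (hx.eval j)).congr_deriv fun t _ => ?_
  simp [dotProduct, Finset.sum_add_distrib]

theorem IsPrimitiveOn.const_mulVec {ι κ : Type*} [Fintype ι] [Fintype κ] {a b : EReal}
    (M : Matrix κ ι ℂ) {x x' : ℝ → ι → ℂ} (hx : IsPrimitiveOn a b x x') :
    IsPrimitiveOn a b (fun t => M *ᵥ x t) (fun t => M *ᵥ x' t) :=
  (IsPrimitiveOn.mulVec (A := fun _ => M) (A' := fun _ => 0)
    (fun i j => .const (M i j)) hx).congr_deriv fun t _ => by simp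

namespace HamSystem

variable {m : ℕ} {a b : EReal} (S : HamSystem m a b)

/-- Since `J² = -1`, the equation can be solved for `y'`; this brings the calculus of primitives to
bear. -/
theorem solves_iff {y f : ℝ → HIdx m → ℂ} : S.Solves y f ↔
    IsPrimitiveOn a b y (fun t => -(sympJ m *ᵥ (S.P t *ᵥ y t + S.W t *ᵥ f t))) := by
  refine and_congr Iff.rfl (eventually_congr (Eventually.of_forall fun t =>
    forall_congr' fun _ => ⟨?_, fun h => ⟨_, h, ?_⟩⟩))
  · rintro ⟨y', hy, e⟩
    beta_reduce
    rw [← e, add_sub_cancel, sympJ_mulVec_mulVec, neg_neg]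
    exact hy
  · rw [mulVec_neg, sympJ_mulVec_mulVec, neg_neg, add_sub_cancel_left]

/-- The coefficient matrix of `y' = -J (P + z W) y`. -/
def coeff (z : ℂ) (t : ℝ) : Matrix (HIdx m) (HIdx m) ℂ := -(sympJ m * (S.P t + z • S.W t))

theorem isSolution_iff {z : ℂ} {y : ℝ → HIdx m → ℂ} :
    S.IsSolution z y ↔ IsPrimitiveOn a b y (fun t => S.coeff z t *ᵥ y t) := by
  have e : (fun t => -(sympJ m *ᵥ (S.P t *ᵥ y t + S.W t *ᵥ (z • y) t)))
      = fun t => S.coeff z t *ᵥ y t := by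
    funext t
    simp only [coeff, Pi.smul_apply, neg_mulVec, ← mulVec_mulVec, add_mulVec, smul_mulVec,
      mulVec_smul]
  rw [IsSolution, solves_iff, e]

theorem coeff_locIntegrable (z : ℂ) : LocIntegrableEntries a b (S.coeff z) := by
  intro i j
  have : (fun t => S.coeff z t i j)
      = fun t => ∑ k, -sympJ m i k * (S.P t k j + z * S.W t k j) := by
    funext t
    simp [coeff, Matrix.mul_apply]
  rw [this]
  exact .fun_sum _ fun k _ s hs t ht =>
    (((S.P_loc k j).locIntegrable s hs t ht).add
      (((S.W_loc k j).locIntegrable s hs t ht).const_mul z)).const_mul _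

variable {S}

theorem Solves.continuousOn {y f : ℝ → HIdx m → ℂ} (h : S.Solves y f) :
    ContinuousOn y (eInterval a b) := (S.solves_iff.1 h).continuousOn

/-- Green's formula in differential form. -/
theorem Solves.bracket {y f x g : ℝ → HIdx m → ℂ} (hy : S.Solves y f) (hx : S.Solves x g) :
    IsPrimitiveOn a b (bracket y x) (fun t => S.wform x f t - S.wform g y t) := by
  have h := (S.solves_iff.1 hx).star_dotProduct ((S.solves_iff.1 hy).const_mulVec (sympJ m))
  refine h.congr_deriv fun t ht => ?_
  rw [star_dotProduct_sympJ_mulVec, mulVec_neg, sympJ_mulVec_mulVec, neg_neg, mulVec_neg,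
    sympJ_mulVec_mulVec, neg_neg, star_add, add_dotProduct, dotProduct_add, star_mulVec,
    star_mulVec, (S.P_herm t ht).eq, (S.W_psd t ht).isHermitian.eq, ← dotProduct_mulVec,
    ← dotProduct_mulVec]
  simp only [wform]
  ring

theorem wform_smul_left (z : ℂ) (x y : ℝ → HIdx m → ℂ) (t : ℝ) :
    S.wform (z • x) y t = star z * S.wform x y t := by
  simp [wform, smul_dotProduct]

theorem wform_smul_right (z : ℂ) (x y : ℝ → HIdx m → ℂ) (t : ℝ) :
    S.wform x (z • y) t = z * S.wform x y t := by
  simp [wform, mulVec_smul, dotProduct_smul]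

theorem IsSolution.bracket {z w : ℂ} {y x : ℝ → HIdx m → ℂ} (hy : S.IsSolution z y)
    (hx : S.IsSolution w x) :
    IsPrimitiveOn a b (bracket y x) (fun t => (z - star w) * S.wform x y t) :=
  (Solves.bracket hy hx).congr_deriv fun t _ => by
    rw [wform_smul_left, wform_smul_right]; ring

theorem wform_locIntegrable {x y : ℝ → HIdx m → ℂ} (hx : ContinuousOn x (eInterval a b))
    (hy : ContinuousOn y (eInterval a b)) : LocIntegrable a b (S.wform x y) := by
  have : S.wform x y = fun t => ∑ i, star (x t i) * ∑ j, S.W t i j * y t j := by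
    funext t
    simp [wform, dotProduct, mulVec]
  rw [this]
  refine .fun_sum _ fun i _ => .continuousOn_mul (.fun_sum _ fun j _ => .mul_continuousOn
    (S.W_loc i j).locIntegrable ((continuous_apply j).comp_continuousOn hy)) ?_
  exact continuous_star.comp_continuousOn ((continuous_apply i).comp_continuousOn hx)

variable {c₀ : ℝ}

theorem IsSolution.eq_zero {z : ℂ} {y : ℝ → HIdx m → ℂ} (hy : S.IsSolution z y)
    (hc : c₀ ∈ eInterval a b) (h0 : y c₀ = 0) {t : ℝ} (ht : t ∈ eInterval a b) : y t = 0 :=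
  (S.isSolution_iff.1 hy).eq_zero_of_linear (S.coeff_locIntegrable z) hc h0 ht

variable (S)

theorem phi_spec (hc : c₀ ∈ eInterval a b) (z : ℂ) (i : HIdx m) :
    S.IsSolution z (S.phi c₀ z i) ∧ S.phi c₀ z i c₀ = Pi.single i 1 := by
  have h : ∃ y : ℝ → HIdx m → ℂ, S.IsSolution z y ∧ y c₀ = Pi.single i 1 := by
    -- The spectral parameter already sits in the coefficient matrix, so the parameter of the power
    -- series is `1`.
    refine ⟨flow (S.coeff z) c₀ (Pi.single i 1) 1, S.isSolution_iff.2 ?_, flow_self 1⟩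
    exact (flow_isPrimitiveOn (S.coeff_locIntegrable z) hc 1).congr_deriv fun t _ => one_smul _ _
  rw [phi, dif_pos h]
  exact h.choose_spec

/-! ### Fundamental matrices and coordinates of solutions -/

/-- The fundamental matrix `Y_z` with `Y_z(c₀) = 1`. -/
noncomputable def fund (c₀ : ℝ) (z : ℂ) (t : ℝ) : Matrix (HIdx m) (HIdx m) ℂ :=
  Matrix.of fun i j => S.phi c₀ z j t i

/-- The solution with value `ξ` at `c₀`. -/
noncomputable def sol (c₀ : ℝ) (z : ℂ) : (HIdx m → ℂ) →ₗ[ℂ] (ℝ → HIdx m → ℂ) where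
  toFun ξ t := S.fund c₀ z t *ᵥ ξ
  map_add' _ _ := funext fun _ => mulVec_add _ _ _
  map_smul' _ _ := funext fun _ => mulVec_smul _ _ _

theorem sol_apply (z : ℂ) (ξ : HIdx m → ℂ) (t : ℝ) : S.sol c₀ z ξ t = S.fund c₀ z t *ᵥ ξ := rfl

theorem sol_single (z : ℂ) (i : HIdx m) : S.sol c₀ z (Pi.single i 1) = S.phi c₀ z i := by
  funext t
  rw [sol_apply, mulVec_single_one]
  rfl

theorem sol_eq_sum (z : ℂ) (ξ : HIdx m → ℂ) : S.sol c₀ z ξ = ∑ i, ξ i • S.phi c₀ z i := by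
  simp only [← sol_single, ← map_smul, ← map_sum]
  congr 1
  ext i
  simp [Pi.single_apply]

variable {S}

theorem sol_isSolution (hc : c₀ ∈ eInterval a b) (z : ℂ) (ξ : HIdx m → ℂ) :
    S.IsSolution z (S.sol c₀ z ξ) := by
  refine S.isSolution_iff.2 (.pi fun i => ?_)
  have h : ∀ k ∈ Finset.univ, IsPrimitiveOn a b (fun t => S.phi c₀ z k t i * ξ k)
      (fun t => (S.coeff z t *ᵥ S.phi c₀ z k t) i * ξ k + S.phi c₀ z k t i * 0) := fun k _ =>
    ((S.isSolution_iff.1 (S.phi_spec hc z k).1).eval i).mul (.const (ξ k))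
  refine (IsPrimitiveOn.sum Finset.univ h).congr_deriv fun t _ => ?_
  have : S.sol c₀ z ξ t = ∑ k, ξ k • S.phi c₀ z k t := by
    rw [sol_eq_sum]; simp
  rw [this, mulVec_sum]
  simp [mulVec_smul, mul_comm]

theorem fund_self (hc : c₀ ∈ eInterval a b) (z : ℂ) : S.fund c₀ z c₀ = 1 := by
  ext i j
  rw [fund, of_apply, (S.phi_spec hc z j).2, Matrix.one_apply, Pi.single_apply]

theorem sol_self (hc : c₀ ∈ eInterval a b) (z : ℂ) (ξ : HIdx m → ℂ) : S.sol c₀ z ξ c₀ = ξ := by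
  rw [sol_apply, fund_self hc, one_mulVec]

theorem IsSolution.eq_sol (hc : c₀ ∈ eInterval a b) {z : ℂ} {y : ℝ → HIdx m → ℂ}
    (hy : S.IsSolution z y) {t : ℝ} (ht : t ∈ eInterval a b) :
    y t = S.sol c₀ z (y c₀) t := by
  have h : IsPrimitiveOn a b (fun t => y t - S.sol c₀ z (y c₀) t)
      (fun t => S.coeff z t *ᵥ (y t - S.sol c₀ z (y c₀) t)) :=
    ((S.isSolution_iff.1 hy).sub (S.isSolution_iff.1 (sol_isSolution hc z (y c₀)))).congr_deriv
      fun t _ => (mulVec_sub _ _ _).symm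
  exact sub_eq_zero.1 (h.eq_zero_of_linear (S.coeff_locIntegrable z) hc
    (by rw [sol_self hc, sub_self]) ht)

theorem sol_eq_zero (hc : c₀ ∈ eInterval a b) {z : ℂ} {ξ : HIdx m → ℂ} {t : ℝ}
    (ht : t ∈ eInterval a b) (h : S.sol c₀ z ξ t = 0) : ξ = 0 := by
  rw [← sol_self (S := S) hc z ξ]
  exact (sol_isSolution hc z ξ).eq_zero ht h hc

variable (S) in
theorem conjTranspose_fund_mul_mul_apply (z w : ℂ) (t : ℝ) (j i : HIdx m) :
    ((S.fund c₀ w t)ᴴ * sympJ m * S.fund c₀ z t) j i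
      = _root_.bracket (S.phi c₀ z i) (S.phi c₀ w j) t := by
  rw [Matrix.mul_assoc, Matrix.mul_apply]
  simp [_root_.bracket, fund, Matrix.mul_apply, dotProduct, mulVec]

/-- For conjugate parameters the factor `z - w̄` in Green's formula vanishes, so the brackets keep
their values at `c₀`. -/
theorem conjTranspose_fund_mul_mul_fund (hc : c₀ ∈ eInterval a b) (z : ℂ) {t : ℝ}
    (ht : t ∈ eInterval a b) : (S.fund c₀ (star z) t)ᴴ * sympJ m * S.fund c₀ z t = sympJ m := by
  ext j i
  have h := ((S.phi_spec hc z i).1.bracket (S.phi_spec hc (star z) j).1).congr_deriv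
    (g' := fun _ => 0) fun t _ => by rw [star_star, sub_self, zero_mul]
  rw [conjTranspose_fund_mul_mul_apply, h.eq_of_deriv_eq_zero ht hc,
    ← conjTranspose_fund_mul_mul_apply, fund_self hc, fund_self hc]
  simp

theorem fund_mul_eq_one (hc : c₀ ∈ eInterval a b) (z : ℂ) {t : ℝ} (ht : t ∈ eInterval a b) :
    S.fund c₀ z t * (-(sympJ m * (S.fund c₀ (star z) t)ᴴ * sympJ m)) = 1 := by
  rw [mul_eq_one_comm, Matrix.neg_mul, Matrix.mul_assoc, Matrix.mul_assoc,
    ← Matrix.mul_assoc (_)ᴴ, conjTranspose_fund_mul_mul_fund hc z ht, sympJ_mul_self, neg_neg]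

/-- The symplectic identity with the factors in the opposite order, since a one-sided inverse of a
square matrix is two-sided. Variation of constants needs this form. -/
theorem fund_mul_sympJ_mul (hc : c₀ ∈ eInterval a b) (z : ℂ) {t : ℝ} (ht : t ∈ eInterval a b) :
    S.fund c₀ z t * sympJ m * (S.fund c₀ (star z) t)ᴴ = sympJ m := by
  have h := congrArg (· * sympJ m) (fund_mul_eq_one (S := S) hc z ht)
  simp only [Matrix.one_mul] at h
  rw [Matrix.mul_assoc, Matrix.neg_mul, Matrix.mul_assoc, sympJ_mul_self] at h
  simpa [Matrix.mul_assoc] using h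

/-- The coordinates `(y, φ_{j, w̄})_c` of a function `y`. -/
noncomputable def coords (S : HamSystem m a b) (c₀ : ℝ) (w : ℂ) (y : ℝ → HIdx m → ℂ) (t : ℝ) :
    HIdx m → ℂ := (S.fund c₀ (star w) t)ᴴ *ᵥ (sympJ m *ᵥ y t)

theorem coords_apply (w : ℂ) (y : ℝ → HIdx m → ℂ) (t : ℝ) (j : HIdx m) :
    S.coords c₀ w y t j = _root_.bracket y (S.phi c₀ (star w) j) t := rfl

theorem eq_fund_mulVec_coords (hc : c₀ ∈ eInterval a b) (w : ℂ) (y : ℝ → HIdx m → ℂ) {t : ℝ}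
    (ht : t ∈ eInterval a b) : y t = S.fund c₀ w t *ᵥ (-(sympJ m *ᵥ S.coords c₀ w y t)) := by
  have h := congrArg (· *ᵥ y t) (fund_mul_eq_one (S := S) hc w ht)
  simp only [one_mulVec] at h
  rw [← h]
  simp only [coords, ← mulVec_mulVec, neg_mulVec]

/-- The coefficient matrix of the system satisfied by the coordinates of solutions. -/
noncomputable def coordCoeff (S : HamSystem m a b) (c₀ : ℝ) (w : ℂ) (t : ℝ) :
    Matrix (HIdx m) (HIdx m) ℂ :=
  -((S.fund c₀ (star w) t)ᴴ * S.W t * S.fund c₀ w t * sympJ m)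

/-- Green's formula against `φ_{j,w̄}` gives the derivative `(z - w) φ_{j,w̄}^* W y`, and expressing
`y` through its coordinates closes the system. The point is that `P` has disappeared: the new
coefficients are controlled by square-integrability of the solutions for `w` and `w̄`. -/
theorem IsSolution.coords (hc : c₀ ∈ eInterval a b) {z : ℂ} (w : ℂ) {y : ℝ → HIdx m → ℂ}
    (hy : S.IsSolution z y) : IsPrimitiveOn a b (S.coords c₀ w y)
      (fun t => (z - w) • S.coordCoeff c₀ w t *ᵥ S.coords c₀ w y t) := by
  refine .pi fun j => (hy.bracket (S.phi_spec hc (star w) j).1).congr_deriv fun t ht => ?_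
  rw [star_star, Pi.smul_apply, smul_eq_mul]
  congr 1
  have : S.wform (S.phi c₀ (star w) j) y t = ((S.fund c₀ (star w) t)ᴴ *ᵥ (S.W t *ᵥ y t)) j := rfl
  rw [this, eq_fund_mulVec_coords (S := S) hc w y ht]
  simp only [coordCoeff, ← mulVec_mulVec, neg_mulVec, mulVec_neg]

theorem coordCoeff_apply (w : ℂ) (t : ℝ) (j i : HIdx m) : S.coordCoeff c₀ w t j i
    = ∑ k, S.wform (S.phi c₀ (star w) j) (S.phi c₀ w k) t * -sympJ m k i := by
  rw [coordCoeff, Matrix.neg_apply, Matrix.mul_apply, ← Finset.sum_neg_distrib]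
  refine Finset.sum_congr rfl fun k _ => ?_
  rw [mul_neg, Matrix.mul_assoc, Matrix.mul_apply]
  rfl

/-- The entries are combinations of `φ^* W φ` with both factors square-integrable, so they are
integrable up to the endpoints. -/
theorem coordCoeff_integrable {w : ℂ} (h : ∀ i, S.phi c₀ w i ∈ S.preL2)
    (h' : ∀ i, S.phi c₀ (star w) i ∈ S.preL2) : IntegrableEntries a b (S.coordCoeff c₀ w) := by
  intro j i
  simp only [coordCoeff_apply]
  exact integrable_finsetSum _ fun k _ => (S.wform_integrable (h' j) (h k)).mul_const _

end HamSystem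

/-! ### Square-integrability of solutions in the limit circle case -/

namespace HamSystem

variable {m : ℕ} {a b : EReal} {S : HamSystem m a b} {c₀ : ℝ}

theorem aestronglyMeasurable_of_continuousOn {f : ℝ → HIdx m → ℂ}
    (hf : ContinuousOn f (eInterval a b)) :
    AEStronglyMeasurable f (volume.restrict (eInterval a b)) :=
  hf.aestronglyMeasurable (measurableSet_eInterval a b)

theorem mem_preL2_congr {f g : ℝ → HIdx m → ℂ} (hf : f ∈ S.preL2)
    (h : ∀ t ∈ eInterval a b, f t = g t) : g ∈ S.preL2 := by
  refine ⟨hf.1.congr ?_, hf.2.congr_fun (fun t ht => ?_) (measurableSet_eInterval a b)⟩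
  · exact (ae_restrict_iff' (measurableSet_eInterval a b)).2 (Eventually.of_forall h)
  · simp only [wform, h t ht]

theorem wform_indicator (s : Set ℝ) (f g : ℝ → HIdx m → ℂ) (t : ℝ) :
    S.wform (s.indicator f) g t = s.indicator (S.wform f g) t := by
  by_cases h : t ∈ s <;> simp [wform, h]

theorem wform_indicator_right (s : Set ℝ) (f g : ℝ → HIdx m → ℂ) (t : ℝ) :
    S.wform f (s.indicator g) t = s.indicator (S.wform f g) t := by
  by_cases h : t ∈ s <;> simp [wform, h]

theorem indicator_mem_preL2 {s : Set ℝ} (hs : MeasurableSet s) {f : ℝ → HIdx m → ℂ}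
    (hf : f ∈ S.preL2) : s.indicator f ∈ S.preL2 := by
  refine ⟨hf.1.indicator hs, ?_⟩
  have : S.wform (s.indicator f) (s.indicator f) = s.indicator (S.wform f f) := by
    funext t
    by_cases h : t ∈ s <;> simp [wform, h]
  rw [this]
  exact hf.2.indicator hs

theorem indicator_Ioc_mem_preL2 {c d : ℝ} (hc : a < (c : EReal)) (hcd : c ≤ d)
    (hd : (d : EReal) < b) {f : ℝ → HIdx m → ℂ} (hf : ContinuousOn f (eInterval a b)) :
    (Set.Ioc c d).indicator f ∈ S.preL2 := by
  refine ⟨(aestronglyMeasurable_of_continuousOn hf).indicator measurableSet_Ioc, ?_⟩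
  have : S.wform ((Set.Ioc c d).indicator f) ((Set.Ioc c d).indicator f)
      = (Set.Ioc c d).indicator (S.wform f f) := by
    funext t
    by_cases h : t ∈ Set.Ioc c d <;> simp [wform, h]
  rw [this]
  have hi := ((wform_locIntegrable (S := S) hf hf).integrableOn_Icc hc hcd hd).mono_set
    (Set.Ioc_subset_Icc_self)
  exact (hi.integrable_indicator measurableSet_Ioc).integrableOn

theorem smul_mem_preL2 {f : ℝ → HIdx m → ℂ} (hf : f ∈ S.preL2) {ζ : ℝ → ℂ} {B : ℝ}
    (hζ : ContinuousOn ζ (eInterval a b)) (hB : ∀ t ∈ eInterval a b, ‖ζ t‖ ≤ B) :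
    (fun t => ζ t • f t) ∈ S.preL2 := by
  have hm := hζ.aestronglyMeasurable (μ := volume) (measurableSet_eInterval a b)
  refine ⟨hm.smul hf.1, ?_⟩
  have : S.wform (fun t => ζ t • f t) (fun t => ζ t • f t)
      = fun t => (star (ζ t) * ζ t) * S.wform f f t := by
    funext t
    simp only [wform, star_smul, mulVec_smul, smul_dotProduct, dotProduct_smul, smul_eq_mul]
    ring
  rw [this]
  refine Integrable.bdd_mul (c := B * B) hf.2 ((continuous_star.comp_aestronglyMeasurable hm).mul hm)
    ((ae_restrict_iff' (measurableSet_eInterval a b)).2 (Eventually.of_forall fun t ht => ?_))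
  have := hB t ht
  rw [norm_mul, norm_star]
  exact mul_le_mul this this (norm_nonneg _) ((norm_nonneg _).trans this)

/-- If all solutions for `w` and `w̄` are square-integrable, then so are all solutions for every
spectral parameter. -/
theorem IsSolution.mem_preL2 (hc : c₀ ∈ eInterval a b) {w : ℂ} (h : ∀ i, S.phi c₀ w i ∈ S.preL2)
    (h' : ∀ i, S.phi c₀ (star w) i ∈ S.preL2) {z : ℂ} {y : ℝ → HIdx m → ℂ}
    (hy : S.IsSolution z y) : y ∈ S.preL2 := by
  have hA := coordCoeff_integrable h h'
  have hx := hy.coords hc w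
  -- The coordinates are bounded on `(a,b)`, so `y` is a combination of the square-integrable
  -- `φ_{k,w}` with bounded continuous coefficients.
  obtain ⟨B, hB⟩ := exists_flow_bound (x₀ := S.coords c₀ w y c₀) hA hc ‖z - w‖
  have hcont : ContinuousOn (fun t => -(sympJ m *ᵥ S.coords c₀ w y t)) (eInterval a b) := by
    have h1 : Continuous fun v : HIdx m → ℂ => -(sympJ m *ᵥ v) := by fun_prop
    exact h1.comp_continuousOn hx.continuousOn
  have hbd : ∀ t ∈ eInterval a b,
      ‖-(sympJ m *ᵥ S.coords c₀ w y t)‖ ≤ entrySum (sympJ m) * B := by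
    intro t ht
    rw [norm_neg]
    refine (norm_mulVec_le_entrySum _ _).trans (mul_le_mul_of_nonneg_left ?_ (entrySum_nonneg _))
    rw [hx.eq_flow hA.loc hc ht]
    exact hB _ le_rfl t ht
  have hmem : (∑ k, fun t => (-(sympJ m *ᵥ S.coords c₀ w y t)) k • S.phi c₀ w k t) ∈ S.preL2 :=
    Submodule.sum_mem _ fun k _ => smul_mem_preL2 (h k)
      ((continuous_apply k).comp_continuousOn hcont)
      fun t ht => (norm_le_pi_norm _ k).trans (hbd t ht)
  refine mem_preL2_congr hmem fun t ht => ?_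
  rw [eq_fund_mulVec_coords (S := S) hc w y ht]
  have := congrFun (sol_eq_sum S (c₀ := c₀) w (-(sympJ m *ᵥ S.coords c₀ w y t))) t
  rw [sol_apply] at this
  rw [this]
  simp

/-! ### Classes in the quotient space -/

/-- The function underlying an element of the pre-space, as a linear map. -/
def PreL2.fnₗ : S.PreL2 →ₗ[ℂ] (ℝ → HIdx m → ℂ) where
  toFun := PreL2.fn
  map_add' _ _ := rfl
  map_smul' _ _ := rfl

/-- The class of an element of the pre-space, as a linear map. -/
noncomputable def PreL2.clsₗ : S.PreL2 →ₗ[ℂ] S.L2 where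
  toFun := PreL2.cls
  map_add' _ _ := rfl
  map_smul' _ _ := rfl

theorem PreL2.inner_def (f g : S.PreL2) :
    inner ℂ f g = ∫ t in eInterval a b, S.wform f.fn g.fn t := rfl

theorem ae_mulVec_eq_zero_of_integral {h : ℝ → HIdx m → ℂ} (hh : h ∈ S.preL2)
    (h0 : ∫ t in eInterval a b, S.wform h h t = 0) :
    ∀ᵐ t : ℝ, t ∈ eInterval a b → S.W t *ᵥ h t = 0 := by
  have hre : ∫ t in eInterval a b, (S.wform h h t).re = 0 := by
    have := integral_re hh.2
    simp only [RCLike.re_to_complex] at this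
    rw [this, h0]; rfl
  have hnn : 0 ≤ᵐ[volume.restrict (eInterval a b)] fun t => (S.wform h h t).re :=
    (ae_restrict_iff' (measurableSet_eInterval a b)).2 (Eventually.of_forall fun t ht =>
      (Complex.le_def.1 (S.wform_self_nonneg h ht)).1)
  have := (setIntegral_eq_zero_iff_of_nonneg_ae hnn hh.2.re).1 hre
  filter_upwards [(ae_restrict_iff' (measurableSet_eInterval a b)).1 this] with t ht htm
  have h1 := S.wform_self_nonneg h htm
  have h2 : S.wform h h t = 0 := Complex.ext (ht htm) (Complex.le_def.1 h1).2.symm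
  exact ((S.W_psd t htm).dotProduct_mulVec_zero_iff _).1 h2

/-- Because `W ≥ 0`, the form `h^* W h` vanishes at a point exactly when `W h` does. -/
theorem PreL2.cls_eq_iff {f g : S.PreL2} :
    f.cls = g.cls ↔ ∀ᵐ t : ℝ, t ∈ eInterval a b → S.W t *ᵥ (f.fn t - g.fn t) = 0 := by
  have e : f.cls = g.cls ↔ inner ℂ (f - g) (f - g) = 0 := by
    rw [PreL2.cls, PreL2.cls, SeparationQuotient.mk_eq_mk, Metric.inseparable_iff, dist_eq_norm,
      inner_self_eq_norm_sq_to_K]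
    simp
  rw [e, PreL2.inner_def]
  refine ⟨fun h => ae_mulVec_eq_zero_of_integral (f - g).2 h, fun h => ?_⟩
  refine setIntegral_eq_zero_of_ae_eq_zero ?_
  filter_upwards [h] with t ht htm
  change star _ ⬝ᵥ (S.W t *ᵥ (f.fn t - g.fn t)) = 0
  rw [ht htm, dotProduct_zero]

end HamSystem

/-! ### Defect spaces and square-integrable solutions -/

namespace HamSystem

variable {m : ℕ} {a b : EReal} {S : HamSystem m a b} {c₀ : ℝ}

theorem continuousOn_phi (hc : c₀ ∈ eInterval a b) (z : ℂ) (i : HIdx m) :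
    ContinuousOn (S.phi c₀ z i) (eInterval a b) := Solves.continuousOn (S.phi_spec hc z i).1

theorem continuousOn_sol (hc : c₀ ∈ eInterval a b) (z : ℂ) (ξ : HIdx m → ℂ) :
    ContinuousOn (S.sol c₀ z ξ) (eInterval a b) := Solves.continuousOn (sol_isSolution hc z ξ)

/-- Variation of constants: if `h` is supported in `(c,d]` and orthogonal to the solutions for `z`,
then `J y' - P y - z̄ W y = W h` has a compactly supported solution. -/
theorem exists_compactSupp_solves (hc₀ : c₀ ∈ eInterval a b) (z : ℂ) {c d : ℝ}
    (hc : a < (c : EReal)) (hcd : c < d) (hd : (d : EReal) < b) {h : ℝ → HIdx m → ℂ}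
    (hh : h ∈ S.preL2) (hsupp : ∀ t, t ∉ Set.Ioc c d → h t = 0)
    (horth : ∀ j, ∫ t in eInterval a b, S.wform (S.phi c₀ z j) h t = 0) :
    ∃ y ∈ S.preL2, S.Solves y (h + star z • y) ∧ CompactSupp a b y := by
  have hsub := Icc_subset_eInterval hc hd
  have hcm : c ∈ eInterval a b := hsub ⟨le_rfl, hcd.le⟩
  have hdm : d ∈ eInterval a b := hsub ⟨hcd.le, le_rfl⟩
  have hsub' : Set.Ioc c d ⊆ eInterval a b := Set.Ioc_subset_Icc_self.trans hsub
  set u : ℝ → HIdx m → ℂ := fun t j => S.wform (S.phi c₀ z j) h t with hu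
  have hu0 : ∀ t, t ∉ Set.Ioc c d → u t = 0 := by
    intro t ht
    funext j
    simp [hu, wform, hsupp t ht]
  have huW : ∀ t, u t = (S.fund c₀ z t)ᴴ *ᵥ (S.W t *ᵥ h t) := fun t => rfl
  have hui : ∀ j, IntegrableOn (fun t => u t j) (Set.Ioc c d) := by
    intro j
    have h1 : IntegrableOn (fun t => S.wform ((Set.Ioc c d).indicator (S.phi c₀ z j)) h t)
        (eInterval a b) :=
      S.wform_integrable (indicator_Ioc_mem_preL2 hc hcd.le hd (continuousOn_phi hc₀ z j)) hh
    refine (h1.mono_set hsub').congr_fun (fun t ht => ?_) measurableSet_Ioc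
    change S.wform _ _ _ = S.wform _ _ _
    rw [wform_indicator, Set.indicator_of_mem ht]
  have huI : ∀ j, Integrable (fun t => u t j) := fun j =>
    (hui j).integrable_of_forall_notMem_eq_zero fun t ht => by rw [hu0 t ht]; rfl
  set g : ℝ → HIdx m → ℂ := fun t => -(sympJ m *ᵥ u t) with hg
  have hgi : LocIntegrable a b g := by
    refine .pi fun i s _ t _ => ?_
    refine Integrable.intervalIntegrable ?_
    simp only [hg, Pi.neg_apply, mulVec, dotProduct]
    exact (integrable_finsetSum _ fun j _ => (huI j).const_mul _).neg
  have hg0 : ∀ t, t ∉ Set.Ioc c d → g t = 0 := by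
    intro t ht
    simp [hg, hu0 t ht]
  -- The ansatz `y = Y_{z̄} k` leads to `k' = -J Y_z^* W h`, by `Y_{z̄} J Y_z^* = J`. Orthogonality
  -- says that the integral of `k'` over `(c,d]` is zero, so `k` returns to zero at `d`.
  set k : ℝ → HIdx m → ℂ := fun t => 0 + ∫ s in c..t, g s with hk
  have hkp : IsPrimitiveOn a b k g := .of_integral hgi hcm 0
  have hkc : ∀ t ≤ c, k t = 0 := by
    intro t ht
    rw [hk]
    simp only [zero_add]
    rw [intervalIntegral.integral_of_ge ht, setIntegral_eq_zero_of_forall_eq_zero, neg_zero]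
    exact fun s hs => hg0 s fun h' => absurd hs.2 (not_le.2 h'.1)
  have hIoc : ∀ j, ∫ t in Set.Ioc c d, u t j = 0 := by
    intro j
    rw [← horth j]
    exact (setIntegral_eq_of_subset_of_forall_sdiff_eq_zero (measurableSet_eInterval a b) hsub'
      fun t ht => by change u t j = 0; rw [hu0 t ht.2]; rfl).symm
  have hgint : ∫ t in Set.Ioc c d, g t = 0 := by
    have hgI : ∀ i, Integrable (fun t => g t i) (volume.restrict (Set.Ioc c d)) := by
      intro i
      simp only [hg, Pi.neg_apply, mulVec, dotProduct]
      exact (integrable_finsetSum _ fun j _ => (hui j).const_mul _).neg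
    funext i
    rw [eval_integral hgI]
    simp only [hg, Pi.neg_apply, mulVec, dotProduct]
    rw [integral_neg, integral_finsetSum _ fun j _ => (hui j).const_mul _]
    simp [integral_const_mul, hIoc]
  have hkd : ∀ t, d ≤ t → k t = 0 := by
    intro t ht
    rw [hk]
    simp only [zero_add]
    rw [intervalIntegral.integral_of_le (hcd.le.trans ht), ← hgint]
    exact setIntegral_eq_of_subset_of_forall_sdiff_eq_zero measurableSet_Ioc
      (Set.Ioc_subset_Ioc_right ht) fun t ht => hg0 t ht.2
  set y : ℝ → HIdx m → ℂ := fun t => S.fund c₀ (star z) t *ᵥ k t with hy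
  have hyp : IsPrimitiveOn a b y
      (fun t => -(sympJ m *ᵥ (S.P t *ᵥ y t + S.W t *ᵥ (h + star z • y) t))) := by
    have hF : ∀ i j, IsPrimitiveOn a b (fun t => S.fund c₀ (star z) t i j)
        (fun t => (S.coeff (star z) t * S.fund c₀ (star z) t) i j) := fun i j =>
      (S.isSolution_iff.1 (S.phi_spec hc₀ (star z) j).1).eval i
    refine (IsPrimitiveOn.mulVec hF hkp).congr_deriv fun t ht => ?_
    have h1 := fund_mul_sympJ_mul (S := S) hc₀ (star z) ht
    rw [star_star] at h1
    have h2 : S.fund c₀ (star z) t *ᵥ g t = -(sympJ m *ᵥ (S.W t *ᵥ h t)) := by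
      rw [← h1, hg]
      simp only [huW, mulVec_neg, mulVec_mulVec, Matrix.mul_assoc]
    rw [h2]
    simp only [coeff, hy, Pi.add_apply, Pi.smul_apply, ← mulVec_mulVec, neg_mulVec, add_mulVec,
      mulVec_add, smul_mulVec, mulVec_smul]
    abel
  have hy0 : ∀ t, t ∉ Set.Ioc c d → y t = 0 := by
    intro t ht
    have : k t = 0 := by
      by_cases h1 : t ≤ c
      · exact hkc t h1
      · exact hkd t (le_of_lt (not_le.1 fun h2 => ht ⟨not_le.1 h1, h2⟩))
    simp [hy, this]
  refine ⟨y, ?_, S.solves_iff.2 hyp, c, d, hc, hcd.le, hd, fun t _ ht => hy0 t fun h' =>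
    ht (Set.Ioc_subset_Icc_self h')⟩
  refine mem_preL2_congr (indicator_Ioc_mem_preL2 hc hcd.le hd hyp.continuousOn) fun t _ => ?_
  by_cases h' : t ∈ Set.Ioc c d
  · rw [Set.indicator_of_mem h']
  · rw [Set.indicator_of_notMem h', hy0 t h']

theorem PreL2.inner_cls (f g : S.PreL2) : inner ℂ f.cls g.cls = inner ℂ f g :=
  SeparationQuotient.inner_mk_mk f g

/-- An element of a defect space agrees, on compact subintervals, with a solution. -/
theorem exists_sol_of_mem_defectSpace (hab : a < b) (hc₀ : c₀ ∈ eInterval a b) (z : ℂ)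
    (v : S.PreL2) (hv : v.cls ∈ S.defectSpace hab z) {c d : ℝ} (hc : a < (c : EReal)) (hcd : c < d)
    (hd : (d : EReal) < b) :
    ∃ ξ, ∀ᵐ t : ℝ, t ∈ Set.Ioc c d → S.W t *ᵥ (v.fn t - S.sol c₀ z ξ t) = 0 := by
  have hsub := Set.Ioc_subset_Icc_self.trans (Icc_subset_eInterval hc hd)
  let e : HIdx m → S.PreL2 := fun j => ⟨(Set.Ioc c d).indicator (S.phi c₀ z j),
    indicator_Ioc_mem_preL2 hc hcd.le hd (continuousOn_phi hc₀ z j)⟩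
  let χv : S.PreL2 := ⟨(Set.Ioc c d).indicator v.fn, indicator_mem_preL2 measurableSet_Ioc v.2⟩
  let V : Submodule ℂ S.L2 := Submodule.span ℂ (Set.range fun j => (e j).cls)
  -- Finite dimension supplies the completeness that the orthogonal projection onto `V` requires.
  have : FiniteDimensional ℂ V := FiniteDimensional.span_of_finite ℂ (Set.finite_range _)
  have : CompleteSpace V := FiniteDimensional.complete ℂ V
  obtain ⟨ξ, hξ⟩ := (Submodule.mem_span_range_iff_exists_fun ℂ).1
    (V.starProjection_apply_mem χv.cls)
  -- The truncated `v` minus its projection onto the truncated solutions. Being orthogonal to all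
  -- solutions, `h` lies in the range of `H₀ - z̄`, hence is orthogonal to `v`; then `(h, h) = 0`.
  let h : S.PreL2 := χv - ∑ j, ξ j • e j
  have hcls : h.cls = χv.cls - V.starProjection χv.cls := by
    rw [← hξ]
    change PreL2.clsₗ h = PreL2.clsₗ χv - ∑ j, ξ j • PreL2.clsₗ (e j)
    simp only [h, map_sub, map_sum, map_smul]
  have hfn : h.fn = (Set.Ioc c d).indicator (v.fn - S.sol c₀ z ξ) := by
    have h1 : h.fn = (Set.Ioc c d).indicator v.fn
        - ∑ j, ξ j • (Set.Ioc c d).indicator (S.phi c₀ z j) := by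
      change PreL2.fnₗ (χv - ∑ j, ξ j • e j) = _
      rw [map_sub, map_sum]
      rfl
    rw [h1, sol_eq_sum]
    funext t
    by_cases ht : t ∈ Set.Ioc c d <;> simp [ht]
  have hsupp : ∀ t, t ∉ Set.Ioc c d → h.fn t = 0 := fun t ht => by
    rw [hfn, Set.indicator_of_notMem ht]
  have heh : ∀ j, inner ℂ (e j) h = 0 := by
    intro j
    rw [← PreL2.inner_cls, hcls]
    exact V.sub_starProjection_mem_orthogonal χv.cls _ (Submodule.subset_span ⟨j, rfl⟩)
  obtain ⟨y, hy, hys, hyc⟩ := exists_compactSupp_solves hc₀ z hc hcd hd h.2 hsupp fun j => by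
    rw [← heh j, PreL2.inner_def]
    refine setIntegral_congr_fun (measurableSet_eInterval a b) fun t _ => ?_
    change _ = S.wform ((Set.Ioc c d).indicator (S.phi c₀ z j)) h.fn t
    rw [wform_indicator]
    by_cases ht : t ∈ Set.Ioc c d
    · rw [Set.indicator_of_mem ht]; rfl
    · rw [Set.indicator_of_notMem ht]
      change star _ ⬝ᵥ (S.W t *ᵥ h.fn t) = 0
      rw [hsupp t ht, mulVec_zero, dotProduct_zero]
  let Y : S.PreL2 := ⟨y, hy⟩
  have hmem : (Y.cls, (h + star z • Y).cls) ∈ S.minGraph hab :=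
    Submodule.le_topologicalClosure _ ⟨Y, h + star z • Y, rfl, rfl, hys, hyc⟩
  have hhv : inner ℂ h v = 0 := by
    have h1 := (Submodule.mem_orthogonal _ _).1 hv h.cls ⟨_, hmem, by
      change PreL2.clsₗ (h + star z • Y) - star z • PreL2.clsₗ Y = PreL2.clsₗ h
      rw [map_add, map_smul, add_sub_cancel_right]⟩
    rwa [PreL2.inner_cls] at h1
  have hhχ : inner ℂ h χv = 0 := by
    rw [← hhv, PreL2.inner_def, PreL2.inner_def]
    refine setIntegral_congr_fun (measurableSet_eInterval a b) fun t _ => ?_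
    change S.wform h.fn ((Set.Ioc c d).indicator v.fn) t = _
    rw [wform_indicator_right]
    by_cases ht : t ∈ Set.Ioc c d
    · rw [Set.indicator_of_mem ht]
    · rw [Set.indicator_of_notMem ht, wform, hsupp t ht, star_zero, zero_dotProduct]
  have hhh : inner ℂ h h = 0 := by
    change inner ℂ h (χv - ∑ j, ξ j • e j) = 0
    have he : ∀ j, inner ℂ h (e j) = 0 := fun j => by
      rw [← inner_conj_symm, heh j, map_zero]
    rw [inner_sub_right, inner_sum, hhχ]
    simp [inner_smul_right, he]
  refine ⟨ξ, ?_⟩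
  filter_upwards [ae_mulVec_eq_zero_of_integral h.2 hhh] with t ht htm
  have := ht (hsub htm)
  change S.W t *ᵥ h.fn t = 0 at this
  rw [hfn, Set.indicator_of_mem htm] at this
  exact this

theorem Definite.restrict (hA : S.Definite) {a' b' : EReal} (ha : a ≤ a') (hb : b' ≤ b) :
    (S.restrict a' b' ha hb).Definite := fun a'' b'' ha' hab hb' y f =>
  hA a'' b'' (ha.trans ha') hab (hb'.trans hb) y f

theorem IsSolution.restrict {z : ℂ} {y : ℝ → HIdx m → ℂ} (hy : S.IsSolution z y) {a' b' : EReal}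
    (ha : a ≤ a') (hb : b' ≤ b) : (S.restrict a' b' ha hb).IsSolution z y :=
  (isSolution_iff _).2 (((isSolution_iff _).1 hy).mono ha hb)

/-- A solution with `W y = 0` on a subinterval vanishes. -/
theorem Definite.sol_eq_zero (hA : S.Definite) (hc₀ : c₀ ∈ eInterval a b) {z : ℂ}
    {ξ : HIdx m → ℂ} {a' b' : EReal} (ha : a ≤ a') (hab : a' < b') (hb : b' ≤ b)
    (h : ∀ᵐ t : ℝ, t ∈ eInterval a' b' → S.W t *ᵥ S.sol c₀ z ξ t = 0) : ξ = 0 := by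
  obtain ⟨t, ht1, ht2⟩ := EReal.lt_iff_exists_real_btwn.1 hab
  have hsol := sol_isSolution (S := S) hc₀ z ξ
  have hsub : eInterval a' b' ⊆ eInterval a b := eInterval_subset ha hb
  refine HamSystem.sol_eq_zero hc₀ (hsub ⟨ht1, ht2⟩)
    (hA a' b' ha hab hb _ _ ?_ (hsol.restrict ha hb) h t ⟨ht1, ht2⟩)
  -- The right-hand side `z y` is in the pre-space of the subinterval because `W y = 0` makes its
  -- integrand vanish.
  refine Submodule.smul_mem _ _ ⟨((continuousOn_sol hc₀ z ξ).mono hsub).aestronglyMeasurable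
    (measurableSet_eInterval a' b'), ?_⟩
  refine (integrable_zero ℝ ℂ (volume.restrict (eInterval a' b'))).congr ?_
  refine (ae_restrict_iff' (measurableSet_eInterval a' b')).2 ?_
  filter_upwards [h] with s hs hsm
  change 0 = star _ ⬝ᵥ (S.W s *ᵥ S.sol c₀ z ξ s)
  rw [hs hsm, dotProduct_zero]

/-- The elements of the defect space at `z` are classes of solutions. -/
theorem exists_cls_eq_of_mem_defectSpace (hA : S.Definite) (hc₀ : c₀ ∈ eInterval a b)
    (hab : a < b) (z : ℂ) {v : S.L2} (hv : v ∈ S.defectSpace hab z) :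
    ∃ (ξ : HIdx m → ℂ) (y : S.PreL2), y.fn = S.sol c₀ z ξ ∧ y.cls = v := by
  obtain ⟨v, rfl⟩ := SeparationQuotient.surjective_mk v
  have hex := fun (c d : ℝ) hc hcd hd =>
    exists_sol_of_mem_defectSpace hab hc₀ z v hv (c := c) (d := d) hc hcd hd
  obtain ⟨p, hp1, hp2⟩ := EReal.lt_iff_exists_real_btwn.1 hc₀.1
  have hp2' := EReal.coe_lt_coe_iff.1 hp2
  -- A reference interval `(p, c₀]` fixes the initial value. Any other interval is enlarged to
  -- contain it, and definiteness on `(p, c₀)` forces the same initial value there.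
  obtain ⟨ξ, hξ⟩ := hex p c₀ hp1 hp2' hc₀.2
  have hall : ∀ᵐ t : ℝ, t ∈ eInterval a b → S.W t *ᵥ (v.fn t - S.sol c₀ z ξ t) = 0 := by
    refine ae_eInterval_of_ae_Icc fun c d hc hcd hd => ?_
    have hc' : a < ((min c p : ℝ) : EReal) := by
      rcases min_choice c p with e | e <;> rw [e]
      exacts [hc, hp1]
    have hd' : ((max d c₀ : ℝ) : EReal) < b := by
      rcases max_choice d c₀ with e | e <;> rw [e]
      exacts [hd, hc₀.2]
    obtain ⟨η, hη⟩ := hex (min c p) (max d c₀) hc'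
      ((min_le_left _ _).trans_lt (hcd.trans_le (le_max_left _ _))) hd'
    have h0 : ξ - η = 0 := by
      refine hA.sol_eq_zero hc₀ (z := z) hp1.le hp2 hc₀.2.le ?_
      filter_upwards [hξ, hη] with t h1 h2 ht
      have ht1 := EReal.coe_lt_coe_iff.1 ht.1
      have ht2 := EReal.coe_lt_coe_iff.1 ht.2
      have e1 := h1 ⟨ht1, ht2.le⟩
      have e2 := h2 ⟨(min_le_right _ _).trans_lt ht1, ht2.le.trans (le_max_right _ _)⟩
      rw [map_sub, Pi.sub_apply, ← sub_sub_sub_cancel_left _ _ (v.fn t), mulVec_sub, e1, e2,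
        sub_zero]
    rw [sub_eq_zero.1 h0]
    have hne : ∀ᵐ t : ℝ, t ≠ min c p := by simp [ae_iff, measure_singleton]
    filter_upwards [hη, hne] with t h1 h2 ht
    exact h1 ⟨lt_of_le_of_ne ((min_le_left _ _).trans ht.1) h2.symm,
      ht.2.trans (le_max_left _ _)⟩
  -- With `y` this solution, `W v = W y` almost everywhere gives `v^* W v = v^* W y = y^* W y`, by
  -- moving the Hermitian `W` across.
  have hmem : S.sol c₀ z ξ ∈ S.preL2 := by
    refine ⟨aestronglyMeasurable_of_continuousOn (continuousOn_sol hc₀ z ξ), v.2.2.congr ?_⟩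
    refine (ae_restrict_iff' (measurableSet_eInterval a b)).2 ?_
    filter_upwards [hall] with t ht htm
    have h1 : S.W t *ᵥ v.fn t = S.W t *ᵥ S.sol c₀ z ξ t := by
      rw [← sub_eq_zero, ← mulVec_sub, ht htm]
    change S.wform v.fn v.fn t = _
    have h2 : S.wform v.fn v.fn t = S.wform v.fn (S.sol c₀ z ξ) t := by simp only [wform, h1]
    rw [h2, ← wform_conj_symm S _ _ htm]
    have h3 : S.wform (S.sol c₀ z ξ) v.fn t = S.wform (S.sol c₀ z ξ) (S.sol c₀ z ξ) t := by
      simp only [wform, h1]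
    rw [h3, wform_conj_symm S _ _ htm]
  refine ⟨ξ, ⟨_, hmem⟩, rfl, ?_⟩
  refine PreL2.cls_eq_iff.2 ?_
  filter_upwards [hall] with t ht htm
  change S.W t *ᵥ (S.sol c₀ z ξ t - v.fn t) = 0
  rw [← neg_sub, mulVec_neg, ht htm, neg_zero]

/-- If the defect index at `z` is `2m`, then all solutions for `z` are square-integrable. -/
theorem sol_mem_preL2_of_finrank (hA : S.Definite) (hc₀ : c₀ ∈ eInterval a b) (hab : a < b) (z : ℂ)
    (h : Module.finrank ℂ (S.defectSpace hab z) = 2 * m) (ξ : HIdx m → ℂ) :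
    S.sol c₀ z ξ ∈ S.preL2 := by
  -- Initial values of square-integrable solutions. The defect space lies in the image of `T`, so
  -- `2m ≤ dim T ≤ 2m` and `T` is everything.
  let T : Submodule ℂ (HIdx m → ℂ) := S.preL2.comap (S.sol c₀ z)
  let F : T →ₗ[ℂ] S.PreL2 := (S.sol c₀ z).restrict (p := T) (q := S.preL2) fun _ hx => hx
  let G : T →ₗ[ℂ] S.L2 := PreL2.clsₗ.comp F
  have hle : S.defectSpace hab z ≤ LinearMap.range G := by
    intro v hv
    obtain ⟨η, y, hy, rfl⟩ := exists_cls_eq_of_mem_defectSpace hA hc₀ hab z hv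
    have hη : η ∈ T := by
      change S.sol c₀ z η ∈ S.preL2
      rw [← hy]; exact y.2
    exact ⟨⟨η, hη⟩, congrArg PreL2.cls (Subtype.ext hy.symm)⟩
  have h1 := Submodule.finrank_mono hle
  have h2 := LinearMap.finrank_range_le G
  have hd : Module.finrank ℂ (HIdx m → ℂ) = 2 * m := by simp [two_mul]
  have h3 : T = ⊤ := by
    refine Submodule.eq_top_of_finrank_eq (le_antisymm (Submodule.finrank_le T) ?_)
    rw [hd, ← h]
    exact h1.trans h2
  have : ξ ∈ T := h3 ▸ Submodule.mem_top
  exact this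

/-- In the limit circle case at both endpoints, all solutions are square-integrable. -/
theorem IsSolution.mem_preL2_of_limitCircle (hA : S.Definite) (hLa : S.LimitCircleLeft)
    (hLb : S.LimitCircleRight) (hc₀ : c₀ ∈ eInterval a b) {z : ℂ} {y : ℝ → HIdx m → ℂ}
    (hy : S.IsSolution z y) : y ∈ S.preL2 := by
  have key : ∀ w : ℂ, (w = Complex.I ∨ w = -Complex.I) → ∀ x, S.IsSolution w x → x ∈ S.preL2 := by
    intro w hw x hx
    have hcont := Solves.continuousOn hx
    have hfull : ∀ (a' b' : EReal) (ha : a ≤ a') (hb : b' ≤ b) (hab : a' < b'),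
        (S.restrict a' b' ha hb).FullDefect hab → IntegrableOn (S.wform x x) (eInterval a' b') := by
      intro a' b' ha hb hab hF
      obtain ⟨t, ht1, ht2⟩ := EReal.lt_iff_exists_real_btwn.1 hab
      have ht : t ∈ eInterval a' b' := ⟨ht1, ht2⟩
      have hfr : Module.finrank ℂ ((S.restrict a' b' ha hb).defectSpace hab w) = 2 * m := by
        rcases hw with rfl | rfl
        exacts [hF.1, hF.2]
      have h1 := sol_mem_preL2_of_finrank (hA.restrict ha hb) ht hab w hfr (x t)
      exact (mem_preL2_congr h1 fun s hs => ((hx.restrict ha hb).eq_sol ht hs).symm).2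
    obtain ⟨c, hac, hcb, hc⟩ := hLa
    obtain ⟨d, had, hdb, hd⟩ := hLb
    have hm : ((max c d : ℝ) : EReal) < b := by
      rcases max_choice c d with e | e <;> rw [e]
      exacts [hcb, hdb]
    refine ⟨aestronglyMeasurable_of_continuousOn hcont, ?_⟩
    -- The interval is covered by `(a,c)`, `[c, max c d]` and `(d,b)`; the two limit circle points
    -- may come in either order.
    refine ((hfull _ _ le_rfl hcb.le hac hc).union
      (((wform_locIntegrable (S := S) hcont hcont).integrableOn_Icc hac (le_max_left c d) hm).union
        (hfull _ _ had.le le_rfl hdb hd))).mono_set fun t ht => ?_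
    by_cases h1 : t < c
    · exact Or.inl ⟨ht.1, EReal.coe_lt_coe_iff.2 h1⟩
    by_cases h2 : d < t
    · exact Or.inr (Or.inr ⟨EReal.coe_lt_coe_iff.2 h2, ht.2⟩)
    · exact Or.inr (Or.inl ⟨not_lt.1 h1, (not_lt.1 h2).trans (le_max_right _ _)⟩)
  exact hy.mem_preL2 hc₀ (fun i => key Complex.I (Or.inl rfl) _ (S.phi_spec hc₀ _ i).1)
    fun i => key (star Complex.I) (Or.inr (by simp)) _ (S.phi_spec hc₀ _ i).1

end HamSystem

/-! ### Order of vanishing of a determinant -/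

/-- In the splitting `K ⊕ L` the map is multiplication by `c` on `K` and the identity on `L`. -/
theorem LinearMap.det_smul_add_id_of_isCompl {𝕜 E : Type*} [Field 𝕜] [AddCommGroup E] [Module 𝕜 E]
    [FiniteDimensional 𝕜 E] {K L : Submodule 𝕜 E} (h : IsCompl K L) (c : 𝕜) :
    LinearMap.det (c • K.projection L h + (LinearMap.id - K.projection L h))
      = c ^ Module.finrank 𝕜 K := by
  have e : c • K.projection L h + (LinearMap.id - K.projection L h)
      = (Submodule.prodEquivOfIsCompl K L h).toLinearMap ∘ₗ
        (LinearMap.prodMap (c • LinearMap.id) LinearMap.id) ∘ₗ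
        (Submodule.prodEquivOfIsCompl K L h).symm.toLinearMap := by
    rw [← LinearMap.comp_assoc, LinearEquiv.eq_comp_toLinearMap_symm]
    refine LinearMap.ext fun x => ?_
    obtain ⟨x, y⟩ := x
    simp [map_add]
  rw [e, LinearMap.det_conj, LinearMap.det_prodMap, LinearMap.det_smul]
  simp

section Order

variable {ι : Type*} [Fintype ι] [DecidableEq ι]

theorem differentiable_matrix_det {D : ℂ → Matrix ι ι ℂ}
    (hD : ∀ i j, Differentiable ℂ fun z => D z i j) : Differentiable ℂ fun z => (D z).det := by
  simp only [Matrix.det_apply]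
  refine Differentiable.fun_sum fun σ _ => ?_
  refine Differentiable.const_smul (Differentiable.fun_finsetProd fun i _ => hD _ _) _

/-- If an analytic family `D` of matrices has no chains of length two at `z₀`, then the order of
vanishing of `det D` at `z₀` is the dimension of the kernel of `D z₀`. -/
theorem analyticOrderAt_det {D : ℂ → Matrix ι ι ℂ} (hD : ∀ i j, Differentiable ℂ fun z => D z i j)
    (z₀ : ℂ) (D' : Matrix ι ι ℂ) (hD' : ∀ i j, HasDerivAt (fun z => D z i j) (D' i j) z₀)
    (hchain : ∀ v₁ v₂, D z₀ *ᵥ v₂ = 0 → D z₀ *ᵥ v₁ + D' *ᵥ v₂ = 0 → v₂ = 0) :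
    analyticOrderAt (fun z => (D z).det) z₀
      = (Module.finrank ℂ (LinearMap.ker (D z₀).mulVecLin) : ℕ∞) := by
  set K := LinearMap.ker (D z₀).mulVecLin with hK
  obtain ⟨L, hKL⟩ := K.exists_isCompl
  set p : Matrix ι ι ℂ := LinearMap.toMatrix' (K.projection L hKL) with hp
  have hpv : ∀ v, p *ᵥ v = K.projection L hKL v := fun v => by
    rw [hp, LinearMap.toMatrix'_mulVec]
  have hpK : ∀ v, D z₀ *ᵥ (p *ᵥ v) = 0 := fun v => by
    have : K.projection L hKL v ∈ K := Submodule.projection_apply_mem _ _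
    rw [hpv]
    exact this
  have hpf : ∀ v, D z₀ *ᵥ v = 0 → p *ᵥ v = v := fun v hv => by
    rw [hpv]
    exact (Submodule.projection_eq_self_iff hKL v).2 hv
  have hDp : D z₀ * p = 0 := by
    refine Matrix.ext_of_mulVec_single fun i => ?_
    rw [← mulVec_mulVec, hpK, zero_mulVec]
  have hpp : p * p = p := by
    refine Matrix.ext_of_mulVec_single fun i => ?_
    rw [← mulVec_mulVec, hpf _ (hpK _)]
  -- Here `p` projects onto the kernel. As `D z₀ * p = 0`, the product `D z * p` is `z - z₀` times
  -- the difference quotient of `D` times `p`; `E` is `D` with this factor divided out.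
  let E : ℂ → Matrix ι ι ℂ := fun z =>
    D z * (1 - p) + (Matrix.of fun i j => dslope (fun z => D z i j) z₀ z) * p
  have hE : ∀ i j, Differentiable ℂ fun z => E z i j := by
    intro i j
    have h1 : ∀ i j, Differentiable ℂ (dslope (fun z => D z i j) z₀) := fun i j =>
      differentiableOn_univ.1 ((Complex.differentiableOn_dslope univ_mem).2
        (hD i j).differentiableOn)
    simp only [E, Matrix.add_apply, Matrix.mul_apply, of_apply]
    exact (Differentiable.fun_sum fun k _ => (hD i k).mul_const _).add
      (Differentiable.fun_sum fun k _ => (h1 i k).mul_const _)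
  have hfac : ∀ z, D z = E z * ((z - z₀) • p + (1 - p)) := by
    intro z
    have h1 : (z - z₀) • (Matrix.of fun i j => dslope (fun z => D z i j) z₀ z) = D z - D z₀ := by
      ext i j
      simpa using sub_smul_dslope (fun z => D z i j) z₀ z
    have h2 : (1 - p) * p = 0 := by rw [sub_mul, one_mul, hpp, sub_self]
    have h3 : p * (1 - p) = 0 := by rw [mul_sub, mul_one, hpp, sub_self]
    have h4 : (1 - p) * (1 - p) = 1 - p := by rw [mul_sub, mul_one, h2, sub_zero]
    have h5 : ∀ B : Matrix ι ι ℂ, (D z * (1 - p) + B * p) * ((z - z₀) • p + (1 - p))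
        = D z * (1 - p) + ((z - z₀) • B) * p := fun B => by
      simp only [add_mul, mul_add, Matrix.mul_assoc, Matrix.mul_smul, Matrix.smul_mul, h2, h3, h4,
        hpp, Matrix.mul_zero, smul_zero, zero_add, add_zero]
      exact add_comm _ _
    rw [h5, h1, sub_mul, hDp, sub_zero, mul_sub, mul_one, sub_add_cancel]
  have hdet : ∀ z, (D z).det = (E z).det * (z - z₀) ^ Module.finrank ℂ K := by
    intro z
    conv_lhs => rw [hfac z, Matrix.det_mul]
    congr 1
    rw [← LinearMap.det_smul_add_id_of_isCompl hKL, ← LinearMap.det_toMatrix']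
    simp [hp]
  -- A vector `v` in the kernel of `E z₀` gives the chain `(v, p v)`. Hence `p v = 0`, then `D z₀ v
  -- = 0`, so `v = p v = 0`.
  have hE0 : (E z₀).det ≠ 0 := by
    intro h0
    obtain ⟨v, hv, hv0⟩ := Matrix.exists_mulVec_eq_zero_iff.2 h0
    have e1 : (Matrix.of fun i j => dslope (fun z => D z i j) z₀ z₀) = D' := by
      ext i j
      rw [of_apply, dslope_same, (hD' i j).deriv]
    have e2 : D z₀ *ᵥ v + D' *ᵥ (p *ᵥ v) = 0 := by
      have : E z₀ *ᵥ v = D z₀ *ᵥ v + D' *ᵥ (p *ᵥ v) := by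
        simp only [E, e1, add_mulVec, mul_sub, hDp, mul_one, sub_zero, mulVec_mulVec]
      rw [← this, hv0]
    have e3 := hchain v (p *ᵥ v) (hpK v) e2
    rw [e3, mulVec_zero, add_zero] at e2
    exact hv (by rw [← hpf v e2, e3])
  have ha : ∀ {f : ℂ → ℂ}, Differentiable ℂ f → AnalyticAt ℂ f z₀ := fun hf => hf.analyticAt z₀
  have e : (fun z => (D z).det)
      = (fun z => (E z).det) * (fun z => (z - z₀) ^ Module.finrank ℂ K) := funext hdet
  have hpow : Differentiable ℂ fun z : ℂ => (z - z₀) ^ Module.finrank ℂ K := by fun_prop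
  rw [e, analyticOrderAt_mul (ha (differentiable_matrix_det hE)) (ha hpow),
    (ha (differentiable_matrix_det hE)).analyticOrderAt_eq_zero.2 hE0, zero_add]
  refine (ha hpow).analyticOrderAt_eq_natCast.2 ⟨fun _ => 1, analyticAt_const, one_ne_zero, ?_⟩
  exact Eventually.of_forall fun z => by simp

end Order

/-! ### Lagrangian boundary conditions -/

section Boundary

variable {m : ℕ} {M N : Matrix (HIdx m) (HIdx m) ℂ}

/-- The boundary form vanishes on the solutions of a self-adjoint boundary condition. -/
theorem boundary_form_eq (hrank : (Matrix.fromCols M N).rank = 2 * m)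
    (hsymm : M * sympJ m * Mᴴ = N * sympJ m * Nᴴ) {u v u' v' : HIdx m → ℂ}
    (h : M *ᵥ u - N *ᵥ v = 0) (h' : M *ᵥ u' - N *ᵥ v' = 0) :
    star u' ⬝ᵥ (sympJ m *ᵥ u) = star v' ⬝ᵥ (sympJ m *ᵥ v) := by
  let C : (HIdx m → ℂ) × (HIdx m → ℂ) →ₗ[ℂ] (HIdx m → ℂ) :=
    M.mulVecLin.comp (LinearMap.fst ℂ _ _) - N.mulVecLin.comp (LinearMap.snd ℂ _ _)
  let R : (HIdx m → ℂ) →ₗ[ℂ] (HIdx m → ℂ) × (HIdx m → ℂ) :=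
    (sympJ m * Mᴴ).mulVecLin.prod (sympJ m * Nᴴ).mulVecLin
  have hd : Module.finrank ℂ (HIdx m → ℂ) = 2 * m := by simp [two_mul]
  have hsurj : ∀ x : HIdx m → ℂ, ∃ p q, M *ᵥ p + N *ᵥ q = x := by
    intro x
    have : LinearMap.range (Matrix.fromCols M N).mulVecLin = ⊤ :=
      Submodule.eq_top_of_finrank_eq (by rw [hd]; exact hrank)
    obtain ⟨w, hw⟩ := LinearMap.range_eq_top.1 this x
    exact ⟨w ∘ Sum.inl, w ∘ Sum.inr, by rw [← hw, mulVecLin_apply, fromCols_mulVec]⟩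
  have hC : LinearMap.range C = ⊤ := by
    refine LinearMap.range_eq_top.2 fun x => ?_
    obtain ⟨p, q, hpq⟩ := hsurj x
    exact ⟨(p, -q), by simpa [C, mulVec_neg] using hpq⟩
  -- If `Mᴴ x = Nᴴ x = 0`, then `x` is orthogonal to the range of `(M, N)`, which is the whole space
  -- by the rank condition.
  have hR : LinearMap.ker R = ⊥ := by
    refine LinearMap.ker_eq_bot'.2 fun x hx => ?_
    have h0 : ∀ B : Matrix (HIdx m) (HIdx m) ℂ, (sympJ m * B) *ᵥ x = 0 → B *ᵥ x = 0 := by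
      intro B hB
      have := congrArg (sympJ m *ᵥ ·) hB
      simpa only [← mulVec_mulVec, sympJ_mulVec_mulVec, mulVec_zero, neg_eq_zero] using this
    have h1 := h0 _ (congrArg Prod.fst hx)
    have h2 := h0 _ (congrArg Prod.snd hx)
    obtain ⟨p, q, hpq⟩ := hsurj x
    have : star x ⬝ᵥ x = 0 := by
      nth_rw 2 [← hpq]
      rw [dotProduct_add, dotProduct_mulVec, dotProduct_mulVec, ← star_star (star x ᵥ* M),
        ← star_star (star x ᵥ* N), star_vecMul, star_vecMul, star_star, h1, h2]
      simp
    exact dotProduct_star_self_eq_zero.1 this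
  have hle : LinearMap.range R ≤ LinearMap.ker C := by
    rintro _ ⟨x, rfl⟩
    change M *ᵥ ((sympJ m * Mᴴ) *ᵥ x) - N *ᵥ ((sympJ m * Nᴴ) *ᵥ x) = 0
    rw [mulVec_mulVec, mulVec_mulVec, ← Matrix.mul_assoc, ← Matrix.mul_assoc, hsymm, sub_self]
  -- Both spaces have dimension `2m`. Thus the boundary condition has the parametrization `u = J Mᴴ
  -- x`, `v = J Nᴴ x`, and the form against `(u', v')` becomes `-(M u')^* x = -(N v')^* x`.
  have heq : LinearMap.range R = LinearMap.ker C := by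
    refine Submodule.eq_of_le_of_finrank_eq hle ?_
    have h1 := LinearMap.finrank_range_add_finrank_ker C
    have h2 := LinearMap.finrank_range_add_finrank_ker R
    rw [hC, finrank_top, Module.finrank_prod] at h1
    rw [hR, finrank_bot] at h2
    omega
  have hmem : (u, v) ∈ LinearMap.range R := by
    rw [heq]
    exact h
  obtain ⟨x, hx⟩ := hmem
  have e1 : u = sympJ m *ᵥ (Mᴴ *ᵥ x) := by
    rw [mulVec_mulVec]; exact (congrArg Prod.fst hx).symm
  have e2 : v = sympJ m *ᵥ (Nᴴ *ᵥ x) := by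
    rw [mulVec_mulVec]; exact (congrArg Prod.snd hx).symm
  have e3 : ∀ (B : Matrix (HIdx m) (HIdx m) ℂ) w, star w ⬝ᵥ (Bᴴ *ᵥ x) = star (B *ᵥ w) ⬝ᵥ x :=
    fun B w => by rw [star_mulVec, dotProduct_mulVec]
  rw [e1, e2, sympJ_mulVec_mulVec, sympJ_mulVec_mulVec, dotProduct_neg, dotProduct_neg, e3, e3,
    sub_eq_zero.1 h']

end Boundary

theorem tendsto_mulVec_const {α ι κ : Type*} [Fintype ι] {l : Filter α}
    {f : α → Matrix κ ι ℂ} {A : Matrix κ ι ℂ} (hf : Tendsto f l (𝓝 A)) (v : ι → ℂ) :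
    Tendsto (fun t => f t *ᵥ v) l (𝓝 (A *ᵥ v)) := by
  have h : Continuous fun B : Matrix κ ι ℂ => B *ᵥ v := by fun_prop
  exact (h.tendsto A).comp hf

theorem tendsto_star_dotProduct_mulVec {α ι : Type*} [Fintype ι] {l : Filter α}
    {f g : α → ι → ℂ} {u v : ι → ℂ} (hf : Tendsto f l (𝓝 u)) (hg : Tendsto g l (𝓝 v))
    (M : Matrix ι ι ℂ) :
    Tendsto (fun t => star (f t) ⬝ᵥ (M *ᵥ g t)) l (𝓝 (star u ⬝ᵥ (M *ᵥ v))) := by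
  simp only [dotProduct, mulVec]
  refine tendsto_finsetSum _ fun i _ => ?_
  refine ((tendsto_pi_nhds.1 hf i).star).mul (tendsto_finsetSum _ fun j _ => ?_)
  exact (tendsto_pi_nhds.1 hg j).const_mul _

namespace HamSystem

variable {m : ℕ} {a b : EReal} {S : HamSystem m a b} {c₀ : ℝ}

/-! ### Boundary values of solutions -/

theorem Phi_mulVec (z : ℂ) (ξ : HIdx m → ℂ) (t : ℝ) :
    S.Phi c₀ z t *ᵥ ξ = S.coords c₀ 0 (S.sol c₀ z ξ) t := by
  have : S.Phi c₀ z t = (S.fund c₀ (star 0) t)ᴴ * sympJ m * S.fund c₀ z t := by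
    ext j i
    rw [conjTranspose_fund_mul_mul_apply, star_zero]
    rfl
  rw [this, coords, sol_apply, mulVec_mulVec, mulVec_mulVec, Matrix.mul_assoc]

/-- With `w = 0` the coordinate system is `x' = z A x`, with `A` independent of `z`, so the spectral
parameter is the variable of the power series. -/
theorem coords_sol_eq_flow (hc : c₀ ∈ eInterval a b)
    (hA : LocIntegrableEntries a b (S.coordCoeff c₀ 0)) (z : ℂ) (ξ : HIdx m → ℂ) {t : ℝ}
    (ht : t ∈ eInterval a b) :
    S.coords c₀ 0 (S.sol c₀ z ξ) t = flow (S.coordCoeff c₀ 0) c₀ (sympJ m *ᵥ ξ) z t := by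
  have h := ((sol_isSolution (S := S) hc z ξ).coords hc 0).congr_deriv
    (g' := fun t => z • S.coordCoeff c₀ 0 t *ᵥ S.coords c₀ 0 (S.sol c₀ z ξ) t)
    fun t _ => by rw [sub_zero]
  rw [h.eq_flow hA hc ht, coords, fund_self hc, sol_self hc]
  simp

/-- Since `Y_0^* J Y_0 = J`, passing to coordinates preserves the symplectic form. The form at an
endpoint can therefore be read off from the boundary values. -/
theorem bracket_eq_coords (hc : c₀ ∈ eInterval a b) (y x : ℝ → HIdx m → ℂ) {t : ℝ}
    (ht : t ∈ eInterval a b) :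
    bracket y x t = star (S.coords c₀ 0 x t) ⬝ᵥ (sympJ m *ᵥ S.coords c₀ 0 y t) := by
  have h := conjTranspose_fund_mul_mul_fund (S := S) hc 0 ht
  rw [star_zero] at h
  rw [bracket, eq_fund_mulVec_coords (S := S) hc 0 x ht, eq_fund_mulVec_coords (S := S) hc 0 y ht]
  rw [star_mulVec, ← dotProduct_mulVec, mulVec_mulVec, mulVec_mulVec, h, star_neg, mulVec_neg,
    neg_dotProduct, dotProduct_neg, neg_neg, sympJ_mulVec_mulVec, dotProduct_neg,
    ← star_dotProduct_sympJ_mulVec]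

theorem exists_Phi_lim (hc : c₀ ∈ eInterval a b)
    (hA : IntegrableEntries a b (S.coordCoeff c₀ 0)) {l : Filter ℝ} (hl : IsEndpoint a b l) :
    ∃ L : ℂ → Matrix (HIdx m) (HIdx m) ℂ, (∀ i j, Differentiable ℂ fun z => L z i j) ∧
      ∀ z, Tendsto (S.Phi c₀ z) l (𝓝 (L z)) := by
  choose L hLd hL using fun i : HIdx m =>
    exists_flow_lim (x₀ := sympJ m *ᵥ Pi.single i 1) hA hc hl
  refine ⟨fun z => Matrix.of fun j i => L i z j, fun j i => ?_, fun z => ?_⟩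
  · exact differentiable_pi.1 (hLd i) j
  · refine tendsto_pi_nhds.2 fun j => tendsto_pi_nhds.2 fun i => ?_
    refine ((tendsto_pi_nhds.1 (hL i z)) j).congr' ?_
    filter_upwards [hl.mem] with t ht
    rw [← coords_sol_eq_flow hc hA.loc z _ ht, ← Phi_mulVec, mulVec_single_one]
    rfl

/-- The Lagrange identity for solutions, in terms of boundary values. -/
theorem boundary_green (hc : c₀ ∈ eInterval a b)
    (hsol : ∀ z ξ, S.sol c₀ z ξ ∈ S.preL2) {z w : ℂ} {Lz Lw Rz Rw : Matrix (HIdx m) (HIdx m) ℂ}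
    (hLz : Tendsto (S.Phi c₀ z) (leftEnd a) (𝓝 Lz)) (hLw : Tendsto (S.Phi c₀ w) (leftEnd a) (𝓝 Lw))
    (hRz : Tendsto (S.Phi c₀ z) (rightEnd b) (𝓝 Rz))
    (hRw : Tendsto (S.Phi c₀ w) (rightEnd b) (𝓝 Rw)) (ξ η : HIdx m → ℂ) :
    star (Rw *ᵥ η) ⬝ᵥ (sympJ m *ᵥ (Rz *ᵥ ξ)) - star (Lw *ᵥ η) ⬝ᵥ (sympJ m *ᵥ (Lz *ᵥ ξ))
      = (z - star w) * ∫ t in eInterval a b, S.wform (S.sol c₀ w η) (S.sol c₀ z ξ) t := by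
  have hab : a < b := hc.1.trans hc.2
  have hf : IntegrableOn (fun t => (z - star w) * S.wform (S.sol c₀ w η) (S.sol c₀ z ξ) t)
      (eInterval a b) := (S.wform_integrable (hsol w η) (hsol z ξ)).const_mul _
  have hb := (sol_isSolution (S := S) hc z ξ).bracket (sol_isSolution hc w η)
  -- Green's formula on the segment from `c₀` to `t`, in the limit at one endpoint. The value at
  -- `c₀` cancels when the two endpoints are subtracted.
  have key : ∀ {l : Filter ℝ} (hl : IsEndpoint a b l) {B C : Matrix (HIdx m) (HIdx m) ℂ} {I : ℂ},
      Tendsto (S.Phi c₀ w) l (𝓝 B) → Tendsto (S.Phi c₀ z) l (𝓝 C) →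
      Tendsto (fun t => ∫ s in c₀..t, (z - star w) * S.wform (S.sol c₀ w η) (S.sol c₀ z ξ) s) l
        (𝓝 I) → star (B *ᵥ η) ⬝ᵥ (sympJ m *ᵥ (C *ᵥ ξ))
          = bracket (S.sol c₀ z ξ) (S.sol c₀ w η) c₀ + I := by
    intro l hl B C I hB hC hI
    have := hl.neBot
    have hlim := tendsto_star_dotProduct_mulVec (tendsto_mulVec_const hB η)
      (tendsto_mulVec_const hC ξ) (sympJ m)
    refine tendsto_nhds_unique hlim ((hI.const_add _).congr' ?_)
    filter_upwards [hl.mem] with t ht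
    rw [hb.integral_eq_sub hf.locIntegrable hc ht, add_sub_cancel, bracket_eq_coords hc _ _ ht,
      ← Phi_mulVec, ← Phi_mulVec]
  rw [key (isEndpoint_rightEnd hab) hRw hRz (tendsto_integral_rightEnd hc hf),
    key (isEndpoint_leftEnd hab) hLw hLz (tendsto_integral_leftEnd hc hf),
    ← integral_const_mul, ← integral_eInterval_split hc hf]
  ring

/-- Dominated convergence: for `z` within distance `1` of `z₀` the solutions are combinations of the
`φ_{k,0}` with coefficients bounded uniformly in `z` and `t`. Continuity is what allows the Lagrange
identity to be differentiated at `z₀`. -/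
theorem continuousAt_integral_wform_sol (hc : c₀ ∈ eInterval a b)
    (hsol : ∀ z ξ, S.sol c₀ z ξ ∈ S.preL2) (w z₀ : ℂ) (ξ η : HIdx m → ℂ) :
    ContinuousAt (fun z => ∫ t in eInterval a b, S.wform (S.sol c₀ w η) (S.sol c₀ z ξ) t) z₀ := by
  have hphi : ∀ z i, S.phi c₀ z i ∈ S.preL2 := fun z i => sol_single S (c₀ := c₀) z i ▸ hsol z _
  have hA := coordCoeff_integrable (hphi 0) (hphi (star 0))
  obtain ⟨B, hB⟩ := exists_flow_bound (x₀ := sympJ m *ᵥ ξ) hA hc (‖z₀‖ + 1)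
  let A := S.coordCoeff c₀ 0
  have hexp : ∀ z, ∀ t ∈ eInterval a b, S.wform (S.sol c₀ w η) (S.sol c₀ z ξ) t
      = ∑ k, S.wform (S.sol c₀ w η) (S.phi c₀ 0 k) t
        * (-(sympJ m *ᵥ flow A c₀ (sympJ m *ᵥ ξ) z t)) k := by
    intro z t ht
    have h1 : S.sol c₀ z ξ t = ∑ k, (-(sympJ m *ᵥ flow A c₀ (sympJ m *ᵥ ξ) z t)) k
        • S.phi c₀ 0 k t := by
      rw [eq_fund_mulVec_coords (S := S) hc 0 (S.sol c₀ z ξ) ht, coords_sol_eq_flow hc hA.loc z ξ ht]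
      have := congrFun (sol_eq_sum S (c₀ := c₀) 0 (-(sympJ m *ᵥ flow A c₀ (sympJ m *ᵥ ξ) z t))) t
      rw [sol_apply] at this
      rw [this]
      simp
    rw [wform, h1, mulVec_sum, dotProduct_sum]
    refine Finset.sum_congr rfl fun k _ => ?_
    rw [mulVec_smul, dotProduct_smul, smul_eq_mul, mul_comm]
    rfl
  refine continuousAt_of_dominated (bound := fun t =>
    ∑ k, ‖S.wform (S.sol c₀ w η) (S.phi c₀ 0 k) t‖ * (entrySum (sympJ m) * B))
    (Eventually.of_forall fun z => (S.wform_integrable (hsol w η) (hsol z ξ)).1) ?_ ?_ ?_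
  · filter_upwards [Metric.ball_mem_nhds z₀ one_pos] with z hz
    have hz' : ‖z‖ ≤ ‖z₀‖ + 1 := by
      have h1 := norm_sub_norm_le z z₀
      have h2 : ‖z - z₀‖ < 1 := mem_ball_iff_norm.1 hz
      linarith
    refine (ae_restrict_iff' (measurableSet_eInterval a b)).2 (Eventually.of_forall fun t ht => ?_)
    rw [hexp z t ht]
    refine (norm_sum_le _ _).trans (Finset.sum_le_sum fun k _ => ?_)
    rw [norm_mul]
    refine mul_le_mul_of_nonneg_left ((norm_le_pi_norm _ k).trans ?_) (norm_nonneg _)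
    rw [norm_neg]
    exact (norm_mulVec_le_entrySum _ _).trans
      (mul_le_mul_of_nonneg_left (hB z hz' t ht) (entrySum_nonneg _))
  · exact integrable_finsetSum _ fun k _ => (S.wform_integrable (hsol w η) (hphi 0 k)).norm.mul_const _
  · refine (ae_restrict_iff' (measurableSet_eInterval a b)).2 (Eventually.of_forall fun t ht => ?_)
    have hfl : Continuous fun z => flow A c₀ (sympJ m *ᵥ ξ) z t :=
      (flow_differentiable hA.loc hc ht).continuous
    have : Continuous fun z => ∑ k, S.wform (S.sol c₀ w η) (S.phi c₀ 0 k) t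
        * (-(sympJ m *ᵥ flow A c₀ (sympJ m *ᵥ ξ) z t)) k := by fun_prop
    simp only [hexp _ t ht]
    exact this.continuousAt

theorem Definite.sol_eq_zero_of_integral (hA : S.Definite) (hc : c₀ ∈ eInterval a b) {z : ℂ}
    {ξ : HIdx m → ℂ} (hsol : S.sol c₀ z ξ ∈ S.preL2)
    (h : ∫ t in eInterval a b, S.wform (S.sol c₀ z ξ) (S.sol c₀ z ξ) t = 0) : ξ = 0 :=
  hA.sol_eq_zero hc le_rfl (hc.1.trans hc.2) le_rfl (ae_mulVec_eq_zero_of_integral hsol h)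

/-- Only `W f` enters the equation, so an identity between classes in `L²_W` turns into a
differential equation for the representative. -/
theorem Solves.congr_right {y f g : ℝ → HIdx m → ℂ} (h : S.Solves y f)
    (hfg : ∀ᵐ t : ℝ, t ∈ eInterval a b → S.W t *ᵥ (f t - g t) = 0) : S.Solves y g := by
  refine S.solves_iff.2 ((S.solves_iff.1 h).congr_ae ?_)
  filter_upwards [hfg] with t ht htm
  have := ht htm
  rw [mulVec_sub, sub_eq_zero] at this
  rw [this]

/-! ### Eigenspaces as kernels of the characteristic matrix -/

/-- The class in `L²_W` of the solution with value `ξ` at `c₀`. -/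
noncomputable def solCls (hsol : ∀ z ξ, S.sol c₀ z ξ ∈ S.preL2) (z : ℂ) :
    (HIdx m → ℂ) →ₗ[ℂ] S.L2 :=
  PreL2.clsₗ.comp ((S.sol c₀ z).codRestrict S.preL2 (hsol z) : (HIdx m → ℂ) →ₗ[ℂ] S.PreL2)

theorem solCls_injective (hA : S.Definite) (hc : c₀ ∈ eInterval a b)
    (hsol : ∀ z ξ, S.sol c₀ z ξ ∈ S.preL2) (z : ℂ) : Function.Injective (solCls hsol z) := by
  refine (injective_iff_map_eq_zero _).2 fun ξ h => ?_
  refine hA.sol_eq_zero hc le_rfl (hc.1.trans hc.2) le_rfl (z := z) ?_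
  have h' : PreL2.cls (⟨S.sol c₀ z ξ, hsol z ξ⟩ : S.PreL2) = PreL2.cls 0 := h
  filter_upwards [PreL2.cls_eq_iff.1 h'] with t ht htm
  have : S.W t *ᵥ (S.sol c₀ z ξ t - 0) = 0 := ht htm
  rwa [sub_zero] at this

/-- The eigenspaces of `H_D` consist of the solutions satisfying the boundary condition. -/
theorem graphEigenspace_eq (hc : c₀ ∈ eInterval a b)
    (hsol : ∀ z ξ, S.sol c₀ z ξ ∈ S.preL2) (M N : Matrix (HIdx m) (HIdx m) ℂ) {z : ℂ}
    {L R : Matrix (HIdx m) (HIdx m) ℂ} (hL : Tendsto (S.Phi c₀ z) (leftEnd a) (𝓝 L))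
    (hR : Tendsto (S.Phi c₀ z) (rightEnd b) (𝓝 R)) :
    graphEigenspace (S.HDGraph c₀ M N) z
      = (LinearMap.ker (M * L - N * R).mulVecLin).map (solCls hsol z) := by
  have hab : a < b := hc.1.trans hc.2
  have hlim : ∀ (ξ : HIdx m → ℂ) {l : Filter ℝ} {B : Matrix (HIdx m) (HIdx m) ℂ},
      Tendsto (S.Phi c₀ z) l (𝓝 B) →
      Tendsto (fun t => fun j => bracket (S.sol c₀ z ξ) (S.phi c₀ 0 j) t) l (𝓝 (B *ᵥ ξ)) := by
    intro ξ l B hB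
    refine (tendsto_mulVec_const hB ξ).congr fun t => ?_
    funext j
    rw [Phi_mulVec, coords_apply, star_zero]
  have hmul : ∀ ξ, (M * L - N * R) *ᵥ ξ = M *ᵥ (L *ᵥ ξ) - N *ᵥ (R *ᵥ ξ) := fun ξ => by
    rw [sub_mulVec, mulVec_mulVec, mulVec_mulVec]
  ext y
  constructor
  · rintro ⟨y₀, f, hy, hf, hs, u, v, hu, hv, huv⟩
    have hcls : f.cls = (z • y₀).cls := by
      rw [hf, LinearMap.prod_apply]
      change z • y = z • y₀.cls
      rw [hy]; rfl
    have hae := PreL2.cls_eq_iff.1 hcls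
    have hfn : (z • y₀).fn = z • y₀.fn := rfl
    rw [hfn] at hae
    -- The graph only says that `f` and `z y₀` have the same class; `f` is now replaced by `z y₀` in
    -- the equation itself.
    have hsolz : S.IsSolution z y₀.fn := hs.congr_right hae
    set ξ := y₀.fn c₀ with hξ
    have heq : ∀ t ∈ eInterval a b, y₀.fn t = S.sol c₀ z ξ t := fun t ht => hsolz.eq_sol hc ht
    have hval : ∀ {l : Filter ℝ} (hl : IsEndpoint a b l) {B : Matrix (HIdx m) (HIdx m) ℂ}
        {w : HIdx m → ℂ}, Tendsto (S.Phi c₀ z) l (𝓝 B) →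
        Tendsto (fun t => fun j => bracket y₀.fn (S.phi c₀ 0 j) t) l (𝓝 w) → w = B *ᵥ ξ := by
      intro l hl B w hB hw
      have := hl.neBot
      refine tendsto_nhds_unique hw ((hlim ξ hB).congr' ?_)
      filter_upwards [hl.mem] with t ht
      funext j
      simp only [bracket, heq t ht]
    rw [hval (isEndpoint_leftEnd hab) hL hu, hval (isEndpoint_rightEnd hab) hR hv, ← hmul] at huv
    refine ⟨ξ, huv, ?_⟩
    have e : y = y₀.cls := hy.symm
    rw [e]
    refine PreL2.cls_eq_iff.2 (Eventually.of_forall fun t ht => ?_)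
    change S.W t *ᵥ (S.sol c₀ z ξ t - y₀.fn t) = 0
    rw [heq t ht, sub_self, mulVec_zero]
  · rintro ⟨ξ, hξ, rfl⟩
    let y₀ : S.PreL2 := ⟨S.sol c₀ z ξ, hsol z ξ⟩
    refine ⟨y₀, z • y₀, rfl, rfl, sol_isSolution hc z ξ, L *ᵥ ξ, R *ᵥ ξ, hlim ξ hL, hlim ξ hR, ?_⟩
    rw [← hmul]
    exact hξ

end HamSystem

/-- The difference quotient of `F` at `z₀` is `G`, so no differentiability of `G` is needed. -/
theorem HasDerivAt.of_sub_mul_continuousAt {F G : ℂ → ℂ} {z₀ : ℂ} (hG : ContinuousAt G z₀)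
    (h : ∀ z, F z = (z - z₀) * G z) : HasDerivAt F (G z₀) z₀ := by
  rw [hasDerivAt_iff_tendsto_slope]
  refine (hG.tendsto.mono_left nhdsWithin_le_nhds).congr' ?_
  filter_upwards [self_mem_nhdsWithin] with z hz
  have : z - z₀ ≠ 0 := sub_ne_zero.2 hz
  rw [slope_def_field, h, h z₀]
  field_simp
  ring

/-! ### Absence of chains and reality of eigenvalues -/

namespace HamSystem

variable {m : ℕ} {a b : EReal} {S : HamSystem m a b} {c₀ : ℝ}

/-- At a real spectral parameter, the characteristic matrix has no chains of length two. -/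
theorem no_chain (hA : S.Definite) (hc : c₀ ∈ eInterval a b)
    (hsol : ∀ z ξ, S.sol c₀ z ξ ∈ S.preL2) {M N : Matrix (HIdx m) (HIdx m) ℂ}
    (hrank : (Matrix.fromCols M N).rank = 2 * m) (hsymm : M * sympJ m * Mᴴ = N * sympJ m * Nᴴ)
    {L R : ℂ → Matrix (HIdx m) (HIdx m) ℂ} (hL : ∀ z, Tendsto (S.Phi c₀ z) (leftEnd a) (𝓝 (L z)))
    (hR : ∀ z, Tendsto (S.Phi c₀ z) (rightEnd b) (𝓝 (R z))) {z₀ : ℂ} (hz₀ : star z₀ = z₀)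
    {L' R' : Matrix (HIdx m) (HIdx m) ℂ} (hL' : ∀ i j, HasDerivAt (fun z => L z i j) (L' i j) z₀)
    (hR' : ∀ i j, HasDerivAt (fun z => R z i j) (R' i j) z₀) {v₁ v₂ : HIdx m → ℂ}
    (h₂ : (M * L z₀ - N * R z₀) *ᵥ v₂ = 0)
    (h₁ : (M * L z₀ - N * R z₀) *ᵥ v₁ + (M * L' - N * R') *ᵥ v₂ = 0) : v₂ = 0 := by
  have hg := fun z ξ η => boundary_green hc hsol (hL z) (hL z₀) (hR z) (hR z₀) ξ η
  simp only [hz₀] at hg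
  have hsub : ∀ (A B : Matrix (HIdx m) (HIdx m) ℂ) (ξ : HIdx m → ℂ),
      (M * A - N * B) *ᵥ ξ = M *ᵥ (A *ᵥ ξ) - N *ᵥ (B *ᵥ ξ) := fun A B ξ => by
    rw [sub_mulVec, mulVec_mulVec, mulVec_mulVec]
  rw [hsub] at h₂
  -- The chain condition says that the boundary values `Φ v₁ + Φ' v₂` satisfy the boundary
  -- condition.
  have h₁' : M *ᵥ (L z₀ *ᵥ v₁ + L' *ᵥ v₂) - N *ᵥ (R z₀ *ᵥ v₁ + R' *ᵥ v₂) = 0 := by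
    rw [mulVec_add, mulVec_add, add_sub_add_comm, ← hsub, ← hsub, h₁]
  have hbf := boundary_form_eq hrank hsymm h₁' h₂
  -- The contribution of `v₁` has equal values at both ends, by the Lagrange identity for two
  -- solutions at the same real parameter. What remains is an identity for `Φ' v₂` against `Φ v₂`.
  have h0 := hg z₀ v₁ v₂
  rw [sub_self, zero_mul, sub_eq_zero] at h0
  simp only [mulVec_add, dotProduct_add] at hbf
  rw [h0, add_right_inj] at hbf
  have hder : ∀ {B : ℂ → Matrix (HIdx m) (HIdx m) ℂ} {B' : Matrix (HIdx m) (HIdx m) ℂ},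
      (∀ i j, HasDerivAt (fun z => B z i j) (B' i j) z₀) → ∀ η : HIdx m → ℂ,
      HasDerivAt (fun z => star η ⬝ᵥ (sympJ m *ᵥ (B z *ᵥ v₂)))
        (star η ⬝ᵥ (sympJ m *ᵥ (B' *ᵥ v₂))) z₀ := by
    intro B B' hB η
    simp only [dotProduct, mulVec]
    exact HasDerivAt.fun_sum fun i _ => HasDerivAt.const_mul _ (HasDerivAt.fun_sum fun j _ =>
      HasDerivAt.const_mul _ (HasDerivAt.fun_sum fun k _ => (hB j k).mul_const _))
  -- The derivative at `z₀` of the boundary form of `Φ_z v₂` against `Φ_{z₀} v₂`, computed entrywise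
  -- and through the Lagrange identity. The first value is zero by the previous step, the second is
  -- the squared norm of the solution.
  have hd1 := (hder hR' (R z₀ *ᵥ v₂)).sub (hder hL' (L z₀ *ᵥ v₂))
  have hd2 := HasDerivAt.of_sub_mul_continuousAt
    (continuousAt_integral_wform_sol hc hsol z₀ z₀ v₂ v₂) fun z => hg z v₂ v₂
  refine hA.sol_eq_zero_of_integral hc (hsol z₀ v₂) ?_
  rw [← hd1.unique hd2, ← hbf, sub_self]

/-- Eigenvalues of `H_D` are real. -/
theorem star_eq_self_of_mulVec_eq_zero (hA : S.Definite) (hc : c₀ ∈ eInterval a b)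
    (hsol : ∀ z ξ, S.sol c₀ z ξ ∈ S.preL2) {M N : Matrix (HIdx m) (HIdx m) ℂ}
    (hrank : (Matrix.fromCols M N).rank = 2 * m) (hsymm : M * sympJ m * Mᴴ = N * sympJ m * Nᴴ)
    {z : ℂ} {L R : Matrix (HIdx m) (HIdx m) ℂ} (hL : Tendsto (S.Phi c₀ z) (leftEnd a) (𝓝 L))
    (hR : Tendsto (S.Phi c₀ z) (rightEnd b) (𝓝 R)) {ξ : HIdx m → ℂ} (hξ : ξ ≠ 0)
    (h : (M * L - N * R) *ᵥ ξ = 0) : star z = z := by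
  have hg := boundary_green hc hsol hL hL hR hR ξ ξ
  rw [sub_mulVec, ← mulVec_mulVec, ← mulVec_mulVec] at h
  rw [boundary_form_eq hrank hsymm h h, sub_self] at hg
  rcases mul_eq_zero.1 hg.symm with h0 | h0
  · exact (sub_eq_zero.1 h0).symm
  · exact absurd (hA.sol_eq_zero_of_integral hc (hsol z ξ) h0) hξ

end HamSystem

/-! ### Multiplicity of eigenvalues -/

theorem theorem3p1 {m : ℕ} {a b : EReal} (S : HamSystem m a b) (hA : S.Definite)
    (hLa : S.LimitCircleLeft) (hLb : S.LimitCircleRight)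
    (c₀ : ℝ) (hac : a < (c₀ : EReal)) (hcb : (c₀ : EReal) < b)
    (M N : Matrix (HIdx m) (HIdx m) ℂ)
    (hrank : (Matrix.fromCols M N).rank = 2 * m)
    (hsymm : M * sympJ m * Mᴴ = N * sympJ m * Nᴴ) :
    (∀ z : ℂ, Tendsto (S.Phi c₀ z) (leftEnd a) (𝓝 (S.PhiLeft c₀ z)) ∧
      Tendsto (S.Phi c₀ z) (rightEnd b) (𝓝 (S.PhiRight c₀ z))) ∧
    Differentiable ℂ (S.Gam c₀ M N) ∧
    ∀ z₀ : ℂ, GraphEigenvalue (S.HDGraph c₀ M N) z₀ →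
      FiniteDimensional ℂ (graphEigenspace (S.HDGraph c₀ M N) z₀) ∧
      analyticOrderAt (S.Gam c₀ M N) z₀ =
        (Module.finrank ℂ (graphEigenspace (S.HDGraph c₀ M N) z₀) : ℕ∞) := by
  have hc : c₀ ∈ eInterval a b := ⟨hac, hcb⟩
  have hab : a < b := hac.trans hcb
  have hphi : ∀ z i, S.phi c₀ z i ∈ S.preL2 := fun z i =>
    (S.phi_spec hc z i).1.mem_preL2_of_limitCircle hA hLa hLb hc
  have hsol : ∀ z ξ, S.sol c₀ z ξ ∈ S.preL2 := fun z ξ =>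
    (HamSystem.sol_isSolution hc z ξ).mem_preL2_of_limitCircle hA hLa hLb hc
  have hI := HamSystem.coordCoeff_integrable (hphi 0) (hphi (star 0))
  obtain ⟨L, hLd, hL⟩ := HamSystem.exists_Phi_lim hc hI (isEndpoint_leftEnd hab)
  obtain ⟨R, hRd, hR⟩ := HamSystem.exists_Phi_lim hc hI (isEndpoint_rightEnd hab)
  have hLeq : ∀ z, S.PhiLeft c₀ z = L z := fun z =>
    have := (isEndpoint_leftEnd hab).neBot
    (hL z).limUnder_eq
  have hReq : ∀ z, S.PhiRight c₀ z = R z := fun z =>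
    have := (isEndpoint_rightEnd hab).neBot
    (hR z).limUnder_eq
  have hGam : S.Gam c₀ M N = fun z => (M * L z - N * R z).det := by
    funext z
    rw [HamSystem.Gam, hLeq, hReq]
  have hderiv : ∀ (z : ℂ) (i j), HasDerivAt (fun z => (M * L z - N * R z) i j)
      ((M * (Matrix.of fun i j => deriv (fun z => L z i j) z)
        - N * (Matrix.of fun i j => deriv (fun z => R z i j) z)) i j) z := by
    intro z i j
    simp only [Matrix.sub_apply, Matrix.mul_apply, Matrix.of_apply]
    exact (HasDerivAt.fun_sum fun k _ => (hLd k j z).hasDerivAt.const_mul _).sub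
      (HasDerivAt.fun_sum fun k _ => (hRd k j z).hasDerivAt.const_mul _)
  have hD : ∀ i j, Differentiable ℂ fun z => (M * L z - N * R z) i j := fun i j z =>
    (hderiv z i j).differentiableAt
  refine ⟨fun z => ⟨by rw [hLeq]; exact hL z, by rw [hReq]; exact hR z⟩, ?_, fun z₀ hz₀ => ?_⟩
  · rw [hGam]
    exact differentiable_matrix_det hD
  have heig := HamSystem.graphEigenspace_eq hc hsol M N (hL z₀) (hR z₀)
  have hinj := HamSystem.solCls_injective hA hc hsol z₀
  rw [heig, hGam]
  refine ⟨inferInstance, ?_⟩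
  rw [← (Submodule.equivMapOfInjective _ hinj _).finrank_eq]
  -- An eigenvector yields a nonzero kernel vector, which makes `z₀` real; the exclusion of chains
  -- depends on this.
  obtain ⟨y, hy0, hy⟩ := hz₀
  have hy' : y ∈ graphEigenspace (S.HDGraph c₀ M N) z₀ := hy
  rw [heig] at hy'
  obtain ⟨ξ, hξ, rfl⟩ := hy'
  have hξ0 : ξ ≠ 0 := fun h => hy0 (by rw [h, map_zero])
  have hreal := HamSystem.star_eq_self_of_mulVec_eq_zero hA hc hsol hrank hsymm (hL z₀) (hR z₀)
    hξ0 hξ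
  exact analyticOrderAt_det hD z₀ _ (hderiv z₀) fun v₁ v₂ h₂ h₁ =>
    HamSystem.no_chain hA hc hsol hrank hsymm hL hR hreal (fun i j => (hLd i j z₀).hasDerivAt)
      (fun i j => (hRd i j z₀).hasDerivAt) h₂ h₁
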